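/- **Corollary (existence and convergence of ADMM).** Let $M\in\mathbb{R}^{m\times n}$ be a nonzero matrix and let $f:\mathbb{R}^n\to\,]-\infty,+\infty]$ and $g:\mathbb{R}^m\to\,]-\infty,+\infty]$ be proper, lower semicontinuous and convex. Consider the problem $$(\mathcal P)\qquad \min\ f(x)+g(z)\quad\text{s.t.}\quad Mx=z,\ x\in\mathbb{R}^n,\ z\in\mathbb{R}^m,$$ and its Lagrangian $L_0(x,z,y)=f(x)+g(z)+\langle y,Mx-z\rangle$. A point $(x^\star,z^\star,y^\star)\in\mathbb{R}^n\times\mathbb{R}^m\times\mathbb{R}^m$ is a *saddle point* of $L_0$ if $L_0(x^\star,z^\star,y)\le L_0(x^\star,z^\star,y^\star)\le L_0(x,z,y^\star)$ for all $(x,z,y)$, and a *critical point* of $L_0$ if $-M^Ty^\star\in\partial f(x^\star)$, $y^\star\in\widehat\partial g(z^\star)$ and $Mx^\star=z^\star$, where $\partial$ is the convex and $\widehat\partial$ the Fréchet subdifferential (both empty outside the effective domain). A solution of $(\mathcal P)$ is a feasible pair of finite value at which the minimum is attained. Write $\operatorname{dom}$ for the effective domain, $\operatorname{ri}$ for the relative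 interior, $f^*$ for the Fenchel conjugate, $\operatorname{ran}\partial f=\bigcup_x\partial f(x)$, and $(\operatorname{rec} f)(y)=\sup_{x\in\operatorname{dom} f}\{f(x+y)-f(x)\}$. Saddle points and critical points of $L_0$ coincide. Suppose that one of the following holds: - (A.1) $L_0$ has a saddle point (equivalently, a critical point); - (A.2) $(\mathcal P)$ has a solution and $0\in\operatorname{ri}(\operatorname{dom} g-M(\operatorname{dom} f))$; and that one of the following holds: - (B.1) $0\in\operatorname{ri}(\operatorname{dom} f^*-\operatorname{ran} M^T)$; - (B.2) $\operatorname{ri}(\operatorname{ran}\partial f)\cap\operatorname{ran} M^T\ne\varnothing$; - (B.3) $(\operatorname{rec} f)(x)>0$ for all $x\in\ker M\setminus\{x\in\mathbb{R}^n:\ -(\operatorname{rec} f)(-x)=(\operatorname{rec} f)(x)=0\}$; - (B.4) $f$ is coercive, i.e. $f(x)\to+\infty$ as $\|x\|\to\infty$ (in particular, this holds if $f$ is supercoercive); - (B.5) $f$ is strongly convex; - (B.6) $M^TM$ is invertible. Let $\gamma>0$. Consider the ADMM iteration $$x^{k+1}\in\operatorname*{argmin}_{x\in\mathbb{R}^n}\Big\{f(x)+\tfrac{\gamma}{2}\big\|Mx-z^k+\tfrac{1}{\gamma}y^k\big\|^2\Big\},$$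 $$z^{k+1}\in\operatorname*{argmin}_{z\in\mathbb{R}^m}\Big\{g(z)+\tfrac{\gamma}{2}\big\|Mx^{k+1}-z+\tfrac{1}{\gamma}y^k\big\|^2\Big\},$$ $$y^{k+1}=y^k+\gamma(Mx^{k+1}-z^{k+1}).$$ Then its steps are well defined: the $x$-problem has a minimizer for all $(z^k,y^k)$, and the $z$-problem has exactly one minimizer for all $(x^{k+1},y^k)$. Moreover, for every starting point $(x^0,z^0,y^0)\in\mathbb{R}^n\times\mathbb{R}^m\times\mathbb{R}^m$ and every sequence $(x^k,z^k,y^k)_{k\ge0}$ generated by this iteration from it, there is a critical point $(x^\star,z^\star,y^\star)$ of $L_0$ (equivalently, a saddle point) such that $$Mx^k\to Mx^\star,\qquad z^k\to z^\star,\qquad y^k\to y^\star,$$ and consequently $(x^\star,z^\star)$ is a solution of $(\mathcal P)$. If, in particular, (B.5) or (B.6) holds, then also $x^k\to x^\star$. -/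

import Mathlib

open Filter Topology
open scoped Pointwise

noncomputable section

namespace ADMM

/-- The linear map `x ↦ M x` between Euclidean spaces. -/
def app {m n : ℕ} (M : Matrix (Fin m) (Fin n) ℝ) (x : EuclideanSpace ℝ (Fin n)) :
    EuclideanSpace ℝ (Fin m) :=
  WithLp.toLp 2 (M.mulVec x)

variable {n m : ℕ}

/-- The effective domain `{x | f x < +∞}`. -/
def dom (f : EuclideanSpace ℝ (Fin n) → EReal) : Set (EuclideanSpace ℝ (Fin n)) :=
  {x | f x < ⊤}

/-- `f` takes values in `]-∞, +∞]` and has a nonempty effective domain. -/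
def IsProper (f : EuclideanSpace ℝ (Fin n) → EReal) : Prop :=
  (∀ x, f x ≠ ⊥) ∧ (dom f).Nonempty

/-- `f` is `α`-convex. At `t = 0` and `t = 1` the convention `0 * (+∞) = 0` is in force. -/
def AlphaConvex (α : ℝ) (f : EuclideanSpace ℝ (Fin n) → EReal) : Prop :=
  ∀ x y : EuclideanSpace ℝ (Fin n), ∀ t ∈ Set.Icc (0 : ℝ) 1,
    f ((1 - t) • x + t • y) ≤
      ((1 - t : ℝ) : EReal) * f x + (t : EReal) * f y
        - ((α / 2 * t * (1 - t) * ‖x - y‖ ^ 2 : ℝ) : EReal)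

/-- Convexity of an extended real-valued function. -/
def IsConvex (f : EuclideanSpace ℝ (Fin n) → EReal) : Prop :=
  ∀ x y : EuclideanSpace ℝ (Fin n), ∀ t ∈ Set.Icc (0 : ℝ) 1,
    f ((1 - t) • x + t • y) ≤ ((1 - t : ℝ) : EReal) * f x + (t : EReal) * f y

/-- Strong convexity: `α`-convexity for some `α > 0`. -/
def IsStronglyConvex (f : EuclideanSpace ℝ (Fin n) → EReal) : Prop :=
  ∃ α : ℝ, 0 < α ∧ AlphaConvex α f

/-- Coercivity: `f x → +∞` as `‖x‖ → ∞`. -/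
def IsCoercive (f : EuclideanSpace ℝ (Fin n) → EReal) : Prop :=
  Tendsto f (Bornology.cobounded (EuclideanSpace ℝ (Fin n))) (𝓝 ⊤)

/-- The convex subdifferential at `x` (empty when `x` is outside the domain). -/
def subdiff (f : EuclideanSpace ℝ (Fin n) → EReal) (x : EuclideanSpace ℝ (Fin n)) :
    Set (EuclideanSpace ℝ (Fin n)) :=
  {u | x ∈ dom f ∧ ∀ y, ((inner ℝ (y - x) u : ℝ) : EReal) + f x ≤ f y}

/-- The Fréchet subdifferential at `x` (empty when `x` is outside the domain). -/
def frechetSubdiff (f : EuclideanSpace ℝ (Fin n) → EReal) (x : EuclideanSpace ℝ (Fin n)) :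
    Set (EuclideanSpace ℝ (Fin n)) :=
  {u | x ∈ dom f ∧
    0 ≤ liminf (fun y => (f y - f x - ((inner ℝ u (y - x) : ℝ) : EReal))
      / ((‖y - x‖ : ℝ) : EReal)) (𝓝[≠] x)}

/-- The range of the subdifferential operator. -/
def ranSubdiff (f : EuclideanSpace ℝ (Fin n) → EReal) : Set (EuclideanSpace ℝ (Fin n)) :=
  {u | ∃ x, u ∈ subdiff f x}

/-- The recession function. -/
def recession (f : EuclideanSpace ℝ (Fin n) → EReal) (y : EuclideanSpace ℝ (Fin n)) : EReal :=
  ⨆ x ∈ dom f, f (x + y) - f x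

/-- The Fenchel conjugate. -/
def conjugate (f : EuclideanSpace ℝ (Fin n) → EReal) (u : EuclideanSpace ℝ (Fin n)) : EReal :=
  ⨆ x, ((inner ℝ u x : ℝ) : EReal) - f x

/-- The set of global minimizers. -/
def argmin (φ : EuclideanSpace ℝ (Fin n) → EReal) : Set (EuclideanSpace ℝ (Fin n)) :=
  {x | ∀ x', φ x ≤ φ x'}

/-- The augmented Lagrangian `L_γ(x, z, y)`. -/
def lagrangian (f : EuclideanSpace ℝ (Fin n) → EReal) (g : EuclideanSpace ℝ (Fin m) → EReal)
    (M : Matrix (Fin m) (Fin n) ℝ) (γ : ℝ)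
    (x : EuclideanSpace ℝ (Fin n)) (z y : EuclideanSpace ℝ (Fin m)) : EReal :=
  f x + g z + ((inner ℝ y (app M x - z) + γ / 2 * ‖app M x - z‖ ^ 2 : ℝ) : EReal)

/-- `(x, z, y)` is a saddle point of the Lagrangian `L_0`. -/
def IsSaddlePoint (f : EuclideanSpace ℝ (Fin n) → EReal) (g : EuclideanSpace ℝ (Fin m) → EReal)
    (M : Matrix (Fin m) (Fin n) ℝ)
    (x : EuclideanSpace ℝ (Fin n)) (z y : EuclideanSpace ℝ (Fin m)) : Prop :=
  (∀ y', lagrangian f g M 0 x z y' ≤ lagrangian f g M 0 x z y) ∧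
    ∀ x' z', lagrangian f g M 0 x z y ≤ lagrangian f g M 0 x' z' y

/-- `(x, z, y)` is a critical point of the Lagrangian `L_0`. -/
def IsCriticalPoint (f : EuclideanSpace ℝ (Fin n) → EReal)
    (g : EuclideanSpace ℝ (Fin m) → EReal) (M : Matrix (Fin m) (Fin n) ℝ)
    (x : EuclideanSpace ℝ (Fin n)) (z y : EuclideanSpace ℝ (Fin m)) : Prop :=
  -(app M.transpose y) ∈ subdiff f x ∧ y ∈ frechetSubdiff g z ∧ app M x - z = 0

/-- `(x, z)` is an optimal solution (of finite value) of
`min f(x) + g(z)` subject to `M x = z`. -/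
def IsSolution (f : EuclideanSpace ℝ (Fin n) → EReal) (g : EuclideanSpace ℝ (Fin m) → EReal)
    (M : Matrix (Fin m) (Fin n) ℝ)
    (x : EuclideanSpace ℝ (Fin n)) (z : EuclideanSpace ℝ (Fin m)) : Prop :=
  app M x = z ∧ f x + g z < ⊤ ∧ ∀ x' z', app M x' = z' → f x + g z ≤ f x' + g z'

/-- The admissible `x`-updates: minimizers of `x ↦ L_γ(x, z, y)`, where the terms that do not
depend on `x` are dropped and the square is completed. -/
def xStep (f : EuclideanSpace ℝ (Fin n) → EReal) (M : Matrix (Fin m) (Fin n) ℝ) (γ : ℝ)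
    (z y : EuclideanSpace ℝ (Fin m)) : Set (EuclideanSpace ℝ (Fin n)) :=
  argmin fun x => f x + ((γ / 2 * ‖app M x - z + (1 / γ) • y‖ ^ 2 : ℝ) : EReal)

/-- The admissible `z`-updates: minimizers of `z ↦ L_γ(x, z, y)`, where the terms that do not
depend on `z` are dropped and the square is completed. -/
def zStep (g : EuclideanSpace ℝ (Fin m) → EReal) (M : Matrix (Fin m) (Fin n) ℝ) (γ : ℝ)
    (x : EuclideanSpace ℝ (Fin n)) (y : EuclideanSpace ℝ (Fin m)) :
    Set (EuclideanSpace ℝ (Fin m)) :=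
  argmin fun z => g z + ((γ / 2 * ‖app M x - z + (1 / γ) • y‖ ^ 2 : ℝ) : EReal)

/-- The sequence `(x k, z k, y k)` is generated by the ADMM with penalty parameter `γ`. -/
def IsADMMSequence (f : EuclideanSpace ℝ (Fin n) → EReal)
    (g : EuclideanSpace ℝ (Fin m) → EReal) (M : Matrix (Fin m) (Fin n) ℝ) (γ : ℝ)
    (x : ℕ → EuclideanSpace ℝ (Fin n)) (z y : ℕ → EuclideanSpace ℝ (Fin m)) : Prop :=
  ∀ k, x (k + 1) ∈ xStep f M γ (z k) (y k) ∧
    z (k + 1) ∈ zStep g M γ (x (k + 1)) (y k) ∧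
    y (k + 1) = y k + γ • (app M (x (k + 1)) - z (k + 1))

end ADMM

end

/-! ### Epigraphs, subgradients and minimizers in terms of real upper bounds -/

noncomputable section

namespace ADMM

variable {n m : ℕ} {f : EuclideanSpace ℝ (Fin n) → EReal}

/-! Each of the six (B) conditions is used only through `KerRecessionSymmetric`: a recession
direction of `f` in `ker M` has its negative as a recession direction too. This makes the `x`-step
solvable (`exists_mem_argmin_proxObjective`): if minimal-norm points of sublevel sets escaped to
infinity, their limiting direction `d` could be subtracted without leaving the sublevel set, yet
this would shorten far-out points. Either (A) condition yields a triple satisfying `IsKKT`. For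
(A.2) the multiplier comes from extending a positive functional on a cone built from both epigraphs
(`exists_isSaddlePoint_of_isSolution`). Monotonicity of subgradients then makes `γ‖z - z⋆‖² + γ⁻¹‖y
- y⋆‖²` decrease along the iteration (`IsADMMSequence.energy_decrease`), so `(z, y)` is bounded with
vanishing increments. Since `Mx` and `z` depend nonexpansively on the data of their steps, every
cluster point of `(z, y)` is reproduced by one step and hence is part of a KKT triple. The energy
relative to it vanishes along a subsequence, so, being monotone, along the whole sequence. The
points `x k` may be unbounded; only `Mx k` is controlled, unless `f` is strongly convex or `M` has a
left inverse. -/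

/-- A point of the effective domain of a proper function has a real value. -/
theorem IsProper.exists_coe (hf : IsProper f) {x : EuclideanSpace ℝ (Fin n)} (hx : f x < ⊤) :
    ∃ r : ℝ, f x = r :=
  ⟨(f x).toReal, (EReal.coe_toReal hx.ne (hf.1 x)).symm⟩

theorem IsProper.exists_coe_of_le (hf : IsProper f) {x : EuclideanSpace ℝ (Fin n)} {s : ℝ}
    (hx : f x ≤ s) : ∃ r : ℝ, f x = r ∧ r ≤ s := by
  obtain ⟨r, hr⟩ := hf.exists_coe (hx.trans_lt (EReal.coe_lt_top s))
  exact ⟨r, hr, by rwa [hr, EReal.coe_le_coe_iff] at hx⟩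

theorem IsProper.exists_point (hf : IsProper f) :
    ∃ (x : EuclideanSpace ℝ (Fin n)) (r : ℝ), f x = r := by
  obtain ⟨x, hx⟩ := hf.2
  exact ⟨x, hf.exists_coe hx⟩

/-- Reduces extended-real inequalities to points `(x, s)` of the epigraph, so that later estimates
take place in `ℝ`. -/
theorem le_of_forall_real {a b : EReal} (h : ∀ s : ℝ, a ≤ s → b ≤ s) : b ≤ a :=
  EReal.le_of_forall_lt_iff_le.1 fun s hs => h s hs.le

/-- Convexity in terms of the epigraph. -/
theorem IsConvex.le_coe (hf : IsConvex f) {x y : EuclideanSpace ℝ (Fin n)} {r s t : ℝ}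
    (hx : f x ≤ r) (hy : f y ≤ s) (ht0 : 0 ≤ t) (ht1 : t ≤ 1) :
    f (x + t • (y - x)) ≤ ((1 - t) * r + t * s : ℝ) := by
  have h := hf x y t ⟨ht0, ht1⟩
  have e : (1 - t) • x + t • y = x + t • (y - x) := by module
  rw [e] at h
  refine h.trans ?_
  rw [EReal.coe_add, EReal.coe_mul, EReal.coe_mul]
  exact add_le_add
    (mul_le_mul_of_nonneg_left hx (EReal.coe_nonneg.2 (sub_nonneg.2 ht1)))
    (mul_le_mul_of_nonneg_left hy (EReal.coe_nonneg.2 ht0))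

/-- Strong convexity in terms of the epigraph. -/
theorem AlphaConvex.le_coe {α : ℝ} (hf : AlphaConvex α f) {x y : EuclideanSpace ℝ (Fin n)}
    {r s t : ℝ} (hx : f x ≤ r) (hy : f y ≤ s) (ht0 : 0 ≤ t) (ht1 : t ≤ 1) :
    f (x + t • (y - x)) ≤
      ((1 - t) * r + t * s - α / 2 * t * (1 - t) * ‖x - y‖ ^ 2 : ℝ) := by
  have h := hf x y t ⟨ht0, ht1⟩
  have e : (1 - t) • x + t • y = x + t • (y - x) := by module
  rw [e] at h
  refine h.trans ?_
  rw [EReal.coe_sub ((1 - t) * r + t * s), EReal.coe_add, EReal.coe_mul, EReal.coe_mul]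
  refine EReal.sub_le_sub (add_le_add
    (mul_le_mul_of_nonneg_left hx (EReal.coe_nonneg.2 (sub_nonneg.2 ht1)))
    (mul_le_mul_of_nonneg_left hy (EReal.coe_nonneg.2 ht0))) le_rfl

/-- The epigraph of a lower semicontinuous function is sequentially closed. -/
theorem le_coe_of_tendsto (hf : LowerSemicontinuous f) {u : ℕ → EuclideanSpace ℝ (Fin n)}
    {r : ℕ → ℝ} {x : EuclideanSpace ℝ (Fin n)} {s : ℝ} (hu : Tendsto u atTop (𝓝 x))
    (hr : Tendsto r atTop (𝓝 s)) (h : ∀ k, f (u k) ≤ r k) : f x ≤ s := by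
  have hlim : Tendsto (fun k => (u k, (r k : EReal))) atTop (𝓝 (x, (s : EReal))) :=
    hu.prodMk_nhds ((continuous_coe_real_ereal.tendsto s).comp hr)
  have hmem : (x, (s : EReal)) ∈ {p : EuclideanSpace ℝ (Fin n) × EReal | f p.1 ≤ p.2} :=
    hf.isClosed_epigraph.mem_of_tendsto hlim (Eventually.of_forall h)
  exact hmem

/-- A proper lower semicontinuous convex function decreases at most linearly. -/
theorem exists_linear_lower_bound (hp : IsProper f) (hl : LowerSemicontinuous f)
    (hc : IsConvex f) (x₀ : EuclideanSpace ℝ (Fin n)) :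
    ∃ a b : ℝ, 0 ≤ a ∧ ∀ x (s : ℝ), f x ≤ s → -(a * ‖x - x₀‖) - b ≤ s := by
  obtain ⟨x₁, r, hr⟩ := hp.exists_point
  obtain ⟨p, -, hmin⟩ := LowerSemicontinuousOn.exists_isMinOn
    (s := Metric.closedBall x₁ 1) ⟨x₁, by simp⟩ (isCompact_closedBall x₁ 1)
    (hl.lowerSemicontinuousOn _)
  have hpr : f p ≤ r := hr ▸ hmin (Metric.mem_closedBall_self zero_le_one)
  obtain ⟨c, hcp, hcr⟩ := hp.exists_coe_of_le hpr
  have key : ∀ x (s : ℝ), f x ≤ s → c - (r - c) * ‖x - x₁‖ ≤ s := by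
    intro x s hs
    by_cases hx : ‖x - x₁‖ ≤ 1
    · have h1 : (c : EReal) ≤ s := by
        rw [← hcp]; exact (hmin (mem_closedBall_iff_norm.2 hx)).trans hs
      have h2 : c ≤ s := EReal.coe_le_coe_iff.1 h1
      nlinarith [norm_nonneg (x - x₁)]
    · push Not at hx
      set t := ‖x - x₁‖ with ht
      have ht0 : 0 < t := by linarith
      -- The weight `t⁻¹` places the point of the segment from `x₁` to `x` on the unit sphere about
      -- `x₁`, where `f ≥ c`.
      have h1 := hc.le_coe hr.le hs (inv_nonneg.2 ht0.le) (inv_le_one_of_one_le₀ hx.le)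
      have h2 : x₁ + t⁻¹ • (x - x₁) ∈ Metric.closedBall x₁ 1 := by
        rw [mem_closedBall_iff_norm, add_sub_cancel_left, norm_smul, norm_inv, norm_norm, ← ht,
          inv_mul_cancel₀ ht0.ne']
      have h3 : (c : EReal) ≤ ((1 - t⁻¹) * r + t⁻¹ * s : ℝ) := by
        rw [← hcp]; exact (hmin h2).trans h1
      have h4 : c ≤ (1 - t⁻¹) * r + t⁻¹ * s := EReal.coe_le_coe_iff.1 h3
      have h5 : t * c ≤ (t - 1) * r + s := by
        calc t * c ≤ t * ((1 - t⁻¹) * r + t⁻¹ * s) := by gcongr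
          _ = (t - 1) * r + s := by field_simp
      nlinarith
  refine ⟨r - c, (r - c) * ‖x₀ - x₁‖ - c, by linarith, fun x s hs => ?_⟩
  have h := key x s hs
  have h6 : ‖x - x₁‖ ≤ ‖x - x₀‖ + ‖x₀ - x₁‖ := norm_sub_le_norm_sub_add_norm_sub _ _ _
  nlinarith

/-- The convex subdifferential in terms of the epigraph. -/
theorem mem_subdiff_iff (hp : IsProper f) {x u : EuclideanSpace ℝ (Fin n)} :
    u ∈ subdiff f x ↔
      ∃ r : ℝ, f x = r ∧ ∀ y (s : ℝ), f y ≤ s → r + inner ℝ u (y - x) ≤ s := by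
  constructor
  · rintro ⟨hx, h⟩
    obtain ⟨r, hr⟩ := hp.exists_coe hx
    refine ⟨r, hr, fun y s hs => ?_⟩
    have := (h y).trans hs
    rw [hr, ← EReal.coe_add, EReal.coe_le_coe_iff] at this
    rw [real_inner_comm]
    linarith
  · rintro ⟨r, hr, h⟩
    refine ⟨?_, fun y => le_of_forall_real fun s hs => ?_⟩
    · show f x < ⊤
      rw [hr]; exact EReal.coe_lt_top r
    · rw [hr, ← EReal.coe_add, EReal.coe_le_coe_iff, real_inner_comm]
      linarith [h y s hs]

/-- Minimizers of the sum of a proper function and a real function. -/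
theorem mem_argmin_add_iff (hp : IsProper f) {q : EuclideanSpace ℝ (Fin n) → ℝ}
    {x : EuclideanSpace ℝ (Fin n)} :
    x ∈ argmin (fun x => f x + ((q x : ℝ) : EReal)) ↔
      ∃ r : ℝ, f x = r ∧ ∀ y (s : ℝ), f y ≤ s → r + q x ≤ s + q y := by
  constructor
  · intro h
    obtain ⟨x₀, r₀, hr₀⟩ := hp.exists_point
    have hx : f x < ⊤ := by
      by_contra hx
      have := h x₀
      simp only [not_lt_top_iff.1 hx, hr₀, ← EReal.coe_add,
        EReal.top_add_coe, top_le_iff, EReal.coe_ne_top] at this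
    obtain ⟨r, hr⟩ := hp.exists_coe hx
    refine ⟨r, hr, fun y s hs => ?_⟩
    have h1 := (h y).trans (add_le_add_left hs _)
    simp only [hr, ← EReal.coe_add, EReal.coe_le_coe_iff] at h1
    exact h1
  · rintro ⟨r, hr, h⟩ y
    show f x + (q x : EReal) ≤ f y + (q y : EReal)
    by_cases hy : f y < ⊤
    · obtain ⟨s, hs⟩ := hp.exists_coe hy
      rw [hr, hs, ← EReal.coe_add, ← EReal.coe_add, EReal.coe_le_coe_iff]
      exact h y s hs.le
    · rw [not_lt_top_iff.1 hy, EReal.top_add_coe]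
      exact le_top

end ADMM
end

/-! ### Generalized proximal steps: existence, optimality, nonexpansiveness -/

noncomputable section

namespace ADMM

variable {n m : ℕ} {f : EuclideanSpace ℝ (Fin n) → EReal}

/-- Every recession direction of `f` in the kernel of `A` is a direction of constancy of `f`. -/
def KerRecessionSymmetric (A : EuclideanSpace ℝ (Fin n) →L[ℝ] EuclideanSpace ℝ (Fin m))
    (f : EuclideanSpace ℝ (Fin n) → EReal) : Prop :=
  ∀ d, A d = 0 → (∀ x, f (x + d) ≤ f x) → ∀ x, f (x - d) ≤ f x

/-- The objective of a generalized proximal step. -/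
def proxObjective (f : EuclideanSpace ℝ (Fin n) → EReal)
    (A : EuclideanSpace ℝ (Fin n) →L[ℝ] EuclideanSpace ℝ (Fin m)) (γ : ℝ)
    (w : EuclideanSpace ℝ (Fin m)) (x : EuclideanSpace ℝ (Fin n)) : EReal :=
  f x + ((γ / 2 * ‖A x - w‖ ^ 2 : ℝ) : EReal)

variable {A : EuclideanSpace ℝ (Fin n) →L[ℝ] EuclideanSpace ℝ (Fin m)} {γ : ℝ}
  {w : EuclideanSpace ℝ (Fin m)}

theorem lowerSemicontinuous_proxObjective (hl : LowerSemicontinuous f) :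
    LowerSemicontinuous (proxObjective f A γ w) := by
  refine hl.add' (Continuous.lowerSemicontinuous ?_) fun x => ?_
  · exact continuous_coe_real_ereal.comp (by fun_prop)
  · exact EReal.continuousAt_add (Or.inr (EReal.coe_ne_bot _)) (Or.inr (EReal.coe_ne_top _))

/-- If sublevel points of a generalized proximal objective escape to infinity in the
direction `d`, then `d` is in the kernel and a recession direction. -/
theorem recession_of_escape (hp : IsProper f) (hl : LowerSemicontinuous f) (hc : IsConvex f)
    (hγ : 0 < γ) {C : ℝ} {x : ℕ → EuclideanSpace ℝ (Fin n)} {d : EuclideanSpace ℝ (Fin n)}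
    (hx : Tendsto (fun k => ‖x k‖) atTop atTop)
    (hd : Tendsto (fun k => ‖x k‖⁻¹ • x k) atTop (𝓝 d))
    (hC : ∀ k, proxObjective f A γ w (x k) ≤ C) :
    A d = 0 ∧ ∀ y, f (y + d) ≤ f y := by
  obtain ⟨a, b, ha, hab⟩ := exists_linear_lower_bound hp hl hc 0
  have hinv : Tendsto (fun k => ‖x k‖⁻¹) atTop (𝓝 0) := tendsto_inv_atTop_zero.comp hx
  have hval : ∀ k, ∃ r : ℝ, f (x k) = r ∧ r + γ / 2 * ‖A (x k) - w‖ ^ 2 ≤ C := by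
    intro k
    have h := hC k
    have hlt : f (x k) < ⊤ := by
      by_contra hx
      rw [proxObjective, not_lt_top_iff.1 hx, EReal.top_add_coe] at h
      exact EReal.coe_ne_top _ (top_le_iff.1 h)
    obtain ⟨r, hr⟩ := hp.exists_coe hlt
    refine ⟨r, hr, ?_⟩
    rwa [proxObjective, hr, ← EReal.coe_add, EReal.coe_le_coe_iff] at h
  choose r hr hrC using hval
  have hev : ∀ᶠ k in atTop, 1 ≤ ‖x k‖ := hx.eventually_ge_atTop 1
  constructor
  -- As `f` decreases at most linearly, the quadratic term grows at most linearly in `‖x k‖`;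
  -- dividing by `‖x k‖²` forces `A d = 0`.
  · have h1 : Tendsto (fun k => γ / 2 * ‖A (‖x k‖⁻¹ • x k) - ‖x k‖⁻¹ • w‖ ^ 2) atTop
        (𝓝 (γ / 2 * ‖A d - (0 : ℝ) • w‖ ^ 2)) :=
      (((((A.continuous.tendsto d).comp hd).sub (hinv.smul_const w)).norm).pow 2).const_mul _
    have h2 : Tendsto (fun k => ‖x k‖⁻¹ * (‖x k‖⁻¹ * (C + b) + a)) atTop
        (𝓝 (0 * (0 * (C + b) + a))) :=
      hinv.mul ((hinv.mul_const _).add_const _)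
    have h3 : γ / 2 * ‖A d - (0 : ℝ) • w‖ ^ 2 ≤ 0 * (0 * (C + b) + a) := by
      refine le_of_tendsto_of_tendsto h1 h2 ?_
      filter_upwards [hev] with k hk
      have h0 : 0 < ‖x k‖ := by linarith
      have e : A (‖x k‖⁻¹ • x k) - ‖x k‖⁻¹ • w = ‖x k‖⁻¹ • (A (x k) - w) := by
        rw [map_smul, smul_sub]
      rw [e, norm_smul, norm_inv, norm_norm]
      have h4 := hab _ _ (hr k).le
      rw [sub_zero] at h4
      have h5 : γ / 2 * ‖A (x k) - w‖ ^ 2 ≤ (C + b) + a * ‖x k‖ := by linarith [hrC k]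
      calc γ / 2 * (‖x k‖⁻¹ * ‖A (x k) - w‖) ^ 2
          = ‖x k‖⁻¹ ^ 2 * (γ / 2 * ‖A (x k) - w‖ ^ 2) := by ring
        _ ≤ ‖x k‖⁻¹ ^ 2 * ((C + b) + a * ‖x k‖) := by gcongr
        _ = ‖x k‖⁻¹ * (‖x k‖⁻¹ * (C + b) + a) := by field_simp
    rw [zero_smul, sub_zero, zero_mul] at h3
    have h6 : ‖A d‖ ^ 2 ≤ 0 := by
      by_contra h7
      push Not at h7
      nlinarith [mul_pos hγ h7]
    exact norm_eq_zero.1 (pow_eq_zero_iff two_ne_zero |>.1 (le_antisymm h6 (sq_nonneg _)))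
  · intro y
    refine le_of_forall_real fun s hs => ?_
    obtain ⟨N, hN⟩ := eventually_atTop.1 hev
    have hsh : Tendsto (fun k => k + N) atTop atTop := tendsto_add_atTop_nat N
    have hinv' := hinv.comp hsh
    have hd' := hd.comp hsh
    -- Convex combinations of `y` and `x k` with weight `‖x k‖⁻¹` on `x k` tend to `y + d`, while
    -- their bounds tend to `s`. The shift by `N` keeps the weights at most `1`.
    refine le_coe_of_tendsto hl
      (u := fun k => y + ‖x (k + N)‖⁻¹ • (x (k + N) - y))
      (r := fun k => (1 - ‖x (k + N)‖⁻¹) * s + ‖x (k + N)‖⁻¹ * C) ?_ ?_ fun k => ?_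
    · have := (hd'.sub (hinv'.smul_const y)).const_add y
      simpa [smul_sub, Function.comp_def] using this
    · have := ((hinv'.const_sub 1).mul_const s).add (hinv'.mul_const C)
      simpa [Function.comp_def] using this
    · have h1 := hN (k + N) (Nat.le_add_left _ _)
      refine hc.le_coe hs ?_ (inv_nonneg.2 (norm_nonneg _)) (inv_le_one_of_one_le₀ h1)
      rw [hr, EReal.coe_le_coe_iff]
      have : 0 ≤ γ / 2 * ‖A (x (k + N)) - w‖ ^ 2 := by positivity
      linarith [hrC (k + N)]

/-- Existence of generalized proximal points. -/
theorem exists_mem_argmin_proxObjective (hp : IsProper f) (hl : LowerSemicontinuous f)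
    (hc : IsConvex f) (hγ : 0 < γ) (hA : KerRecessionSymmetric A f) :
    (argmin (proxObjective f A γ w)).Nonempty := by
  have hlF : LowerSemicontinuous (proxObjective f A γ w) := lowerSemicontinuous_proxObjective hl
  by_cases hbdd : ∃ R : ℝ, ∀ v, ∃ x, ‖x‖ ≤ R ∧ proxObjective f A γ w x ≤ proxObjective f A γ w v
  · obtain ⟨R, hR⟩ := hbdd
    obtain ⟨x₀, hx₀, -⟩ := hR 0
    obtain ⟨p, -, hmin⟩ := LowerSemicontinuousOn.exists_isMinOn
      (s := Metric.closedBall (0 : EuclideanSpace ℝ (Fin n)) R) ⟨x₀, by simpa using hx₀⟩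
      (isCompact_closedBall _ _) (hlF.lowerSemicontinuousOn _)
    refine ⟨p, fun v => ?_⟩
    obtain ⟨x, hx, hxv⟩ := hR v
    exact (hmin (by simpa using hx : x ∈ Metric.closedBall _ R)).trans hxv
  · exfalso
    push Not at hbdd
    choose v hv using fun k : ℕ => hbdd k
    -- Points of least norm in the sublevel sets of `v k`. These sets miss the ball of radius `k`,
    -- so the points escape.
    have hmin : ∀ k, ∃ x, proxObjective f A γ w x ≤ proxObjective f A γ w (v k) ∧
        ∀ y, proxObjective f A γ w y ≤ proxObjective f A γ w (v k) → ‖x‖ ≤ ‖y‖ := by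
      intro k
      have hcl : IsClosed (proxObjective f A γ w ⁻¹' Set.Iic (proxObjective f A γ w (v k))) :=
        hlF.isClosed_preimage _
      obtain ⟨x, hx, hxd⟩ := hcl.exists_infDist_eq_dist ⟨v k, Set.mem_preimage.2 Set.self_mem_Iic⟩ 0
      refine ⟨x, hx, fun y hy => ?_⟩
      have hy' : y ∈ proxObjective f A γ w ⁻¹' Set.Iic (proxObjective f A γ w (v k)) := hy
      have h := Metric.infDist_le_dist_of_mem (x := 0) hy'
      rw [hxd, dist_zero_left, dist_zero_left] at h
      exact h
    choose x hx hxmin using hmin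
    have hxk : ∀ k : ℕ, (k : ℝ) < ‖x k‖ := fun k => by
      by_contra h
      exact absurd (hx k) (not_le.2 (hv k (x k) (not_lt.1 h)))
    obtain ⟨x₀, r₀, hr₀⟩ := hp.exists_point
    -- From index `N` on, `x₀` lies in the ball of radius `k`, so its finite objective value bounds
    -- those of `v k` and `x k`.
    obtain ⟨N, hN⟩ := exists_nat_ge ‖x₀‖
    have hsphere : ∀ k, ‖x k‖⁻¹ • x k ∈ Metric.sphere (0 : EuclideanSpace ℝ (Fin n)) 1 := by
      intro k
      have h0 : 0 < ‖x k‖ := (Nat.cast_nonneg k).trans_lt (hxk k)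
      rw [mem_sphere_zero_iff_norm, norm_smul, norm_inv, norm_norm, inv_mul_cancel₀ h0.ne']
    obtain ⟨d, hd, φ, hφ, hlim⟩ := (isCompact_sphere (0 : EuclideanSpace ℝ (Fin n)) 1).tendsto_subseq
      (fun k => hsphere (k + N))
    have hd1 : ‖d‖ = 1 := by simpa using hd
    set y : ℕ → EuclideanSpace ℝ (Fin n) := fun k => x (φ k + N) with hy
    have hylt : ∀ k : ℕ, (k : ℝ) < ‖y k‖ := fun k => by
      refine lt_of_le_of_lt ?_ (hxk (φ k + N))
      exact_mod_cast (hφ.id_le k).trans (Nat.le_add_right _ _)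
    have hytop : Tendsto (fun k => ‖y k‖) atTop atTop :=
      tendsto_atTop_mono (fun k => (hylt k).le) tendsto_natCast_atTop_atTop
    have hyd : Tendsto (fun k => ‖y k‖⁻¹ • y k) atTop (𝓝 d) := hlim
    have hyC : ∀ k, proxObjective f A γ w (y k) ≤ ((r₀ + γ / 2 * ‖A x₀ - w‖ ^ 2 : ℝ) : EReal) := by
      intro k
      refine (hx _).trans ?_
      have h := hv (φ k + N) x₀ (hN.trans (by exact_mod_cast Nat.le_add_left _ _))
      rw [EReal.coe_add, ← hr₀]
      exact h.le
    obtain ⟨hAd, hrec⟩ := recession_of_escape hp hl hc hγ hytop hyd hyC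
    have hle : ∀ k, ‖y k‖ ≤ ‖y k - d‖ := by
      intro k
      refine hxmin _ _ (le_trans ?_ (hx _))
      show f (y k - d) + _ ≤ f (y k) + _
      rw [map_sub, hAd, sub_zero]
      exact add_le_add_left (hA d hAd hrec _) _
    -- Squaring `hle` gives `⟪y k, d⟫ ≤ 1 / 2`; division by `‖y k‖` yields `‖d‖² ≤ 0` in the limit,
    -- against `‖d‖ = 1`.
    have h1 : Tendsto (fun k => inner ℝ (‖y k‖⁻¹ • y k) d) atTop (𝓝 (inner ℝ d d)) :=
      hyd.inner tendsto_const_nhds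
    have h2 : Tendsto (fun k => ‖y k‖⁻¹ * (1 / 2)) atTop (𝓝 (0 * (1 / 2))) :=
      (tendsto_inv_atTop_zero.comp hytop).mul_const _
    have h3 : inner ℝ d d ≤ (0 : ℝ) * (1 / 2) := by
      refine le_of_tendsto_of_tendsto' h1 h2 fun k => ?_
      rw [real_inner_smul_left]
      refine mul_le_mul_of_nonneg_left ?_ (inv_nonneg.2 (norm_nonneg _))
      have h4 := pow_le_pow_left₀ (norm_nonneg _) (hle k) 2
      rw [norm_sub_sq_real, hd1] at h4
      linarith
    rw [real_inner_self_eq_norm_sq, hd1] at h3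
    norm_num at h3

/-- The optimality condition of a generalized proximal point. -/
theorem optimality_of_mem_argmin (hp : IsProper f) (hc : IsConvex f)
    {x : EuclideanSpace ℝ (Fin n)} (hx : x ∈ argmin (proxObjective f A γ w)) :
    ∃ r : ℝ, f x = r ∧
      ∀ y (s : ℝ), f y ≤ s → r - γ * inner ℝ (A x - w) (A y - A x) ≤ s := by
  obtain ⟨r, hr, h⟩ := (mem_argmin_add_iff hp (q := fun x => γ / 2 * ‖A x - w‖ ^ 2)).1 hx
  refine ⟨r, hr, fun y s hs => ?_⟩
  -- Minimality is tested on the segment towards `y` and divided by `t`; the remaining quadratic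
  -- term vanishes as `t → 0`.
  have key : ∀ t : ℝ, 0 < t → t ≤ 1 →
      r - γ * inner ℝ (A x - w) (A y - A x) ≤ s + t * (γ / 2 * ‖A y - A x‖ ^ 2) := by
    intro t ht0 ht1
    have h1 := h _ _ (hc.le_coe hr.le hs ht0.le ht1)
    have e : A (x + t • (y - x)) - w = (A x - w) + t • (A y - A x) := by
      rw [map_add, map_smul, map_sub]; abel
    simp only [e, norm_add_sq_real, norm_smul, real_inner_smul_right, Real.norm_eq_abs,
      mul_pow, sq_abs] at h1
    have h2 : t * (r - γ * inner ℝ (A x - w) (A y - A x)) ≤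
        t * (s + t * (γ / 2 * ‖A y - A x‖ ^ 2)) := by linarith
    exact le_of_mul_le_mul_left h2 ht0
  have hlim : Tendsto (fun t : ℝ => s + t * (γ / 2 * ‖A y - A x‖ ^ 2)) (𝓝[>] 0)
      (𝓝 (s + 0 * (γ / 2 * ‖A y - A x‖ ^ 2))) :=
    ((tendsto_id.mul_const _).const_add s).mono_left nhdsWithin_le_nhds
  rw [zero_mul, add_zero] at hlim
  refine ge_of_tendsto hlim ?_
  filter_upwards [Ioc_mem_nhdsGT (zero_lt_one' ℝ)] with t ht using key t ht.1 ht.2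

/-- The image of a generalized proximal point depends nonexpansively on the datum. -/
theorem norm_sub_le_of_mem_argmin (hp : IsProper f) (hc : IsConvex f) (hγ : 0 < γ)
    {w' : EuclideanSpace ℝ (Fin m)} {x x' : EuclideanSpace ℝ (Fin n)}
    (hx : x ∈ argmin (proxObjective f A γ w)) (hx' : x' ∈ argmin (proxObjective f A γ w')) :
    ‖A x - A x'‖ ≤ ‖w - w'‖ := by
  obtain ⟨r, hr, h⟩ := optimality_of_mem_argmin hp hc hx
  obtain ⟨r', hr', h'⟩ := optimality_of_mem_argmin hp hc hx'
  have h1 := h _ _ hr'.le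
  have h2 := h' _ _ hr.le
  -- Each optimality condition, tested at the other minimizer and added, gives firm
  -- nonexpansiveness; Cauchy–Schwarz finishes.
  have h3 : 0 ≤ γ * (inner ℝ (w - w') (A x - A x') - ‖A x - A x'‖ ^ 2) := by
    rw [← real_inner_self_eq_norm_sq]
    simp only [inner_sub_left, inner_sub_right] at h1 h2 ⊢
    rw [real_inner_comm (A x) (A x')] at *
    linarith
  have h4 := nonneg_of_mul_nonneg_right h3 hγ
  have h5 := real_inner_le_norm (w - w') (A x - A x')
  by_contra hlt
  push Not at hlt
  nlinarith [norm_nonneg (w - w'), norm_nonneg (A x - A x')]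

end ADMM
end

/-! ### Recession directions and the six solvability conditions -/

noncomputable section

namespace ADMM

variable {n m : ℕ} {f : EuclideanSpace ℝ (Fin n) → EReal}

/-- A point of the relative interior can be moved slightly in every direction of the span. -/
theorem exists_pos_add_smul_mem {s : Set (EuclideanSpace ℝ (Fin n))}
    {c v : EuclideanSpace ℝ (Fin n)} (hc : c ∈ intrinsicInterior ℝ s)
    (hv : v ∈ (affineSpan ℝ s).direction) : ∃ ε : ℝ, 0 < ε ∧ c + ε • v ∈ s := by
  obtain ⟨c, hci, rfl⟩ := mem_intrinsicInterior.1 hc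
  have hmem : ∀ t : ℝ, (c : EuclideanSpace ℝ (Fin n)) + t • v ∈ affineSpan ℝ s := fun t => by
    rw [add_comm]
    exact AffineSubspace.vadd_mem_of_mem_direction (Submodule.smul_mem _ t hv) c.2
  let F : ℝ → affineSpan ℝ s := fun t => ⟨c + t • v, hmem t⟩
  have hF : Continuous F := by
    refine Continuous.subtype_mk ?_ _
    fun_prop
  have hF0 : F 0 = c := Subtype.ext (by simp [F])
  have hnear : ∀ᶠ t in 𝓝 (0 : ℝ), F t ∈ interior ((↑) ⁻¹' s : Set (affineSpan ℝ s)) :=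
    hF.continuousAt.eventually_mem (by rw [hF0]; exact isOpen_interior.mem_nhds hci)
  obtain ⟨t, ht, ht0⟩ :=
    ((hnear.filter_mono nhdsWithin_le_nhds).and (self_mem_nhdsWithin (s := Set.Ioi (0 : ℝ)))).exists
  have hFt : F t ∈ ((↑) ⁻¹' s : Set (affineSpan ℝ s)) := interior_subset ht
  exact ⟨t, ht0, hFt⟩

/-- A linear form that is maximal over a set at a point of its relative interior is constant. -/
theorem inner_eq_of_le_of_mem_intrinsicInterior {s : Set (EuclideanSpace ℝ (Fin n))}
    {c d : EuclideanSpace ℝ (Fin n)} (hc : c ∈ intrinsicInterior ℝ s)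
    (hle : ∀ u ∈ s, inner ℝ u d ≤ inner ℝ c d) :
    ∀ u ∈ s, inner ℝ u d = inner ℝ c d := by
  intro u hu
  refine le_antisymm (hle u hu) ?_
  -- From `c` one can move slightly beyond, away from `u`; a strict drop at `u` would give a value
  -- above the maximum there.
  have hv : c - u ∈ (affineSpan ℝ s).direction :=
    AffineSubspace.vsub_mem_direction (subset_affineSpan ℝ s (intrinsicInterior_subset hc))
      (subset_affineSpan ℝ s hu)
  obtain ⟨ε, hε, hmem⟩ := exists_pos_add_smul_mem hc hv
  have h := hle _ hmem
  rw [inner_add_left, real_inner_smul_left, inner_sub_left] at h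
  by_contra hlt
  push Not at hlt
  nlinarith [mul_pos hε (sub_pos.2 hlt)]

/-- A direction in which every subgradient is nonpositive is a recession direction. -/
theorem le_of_ranSubdiff_inner_nonpos (hp : IsProper f) (hl : LowerSemicontinuous f)
    (hc : IsConvex f) {d : EuclideanSpace ℝ (Fin n)}
    (hd : ∀ u ∈ ranSubdiff f, inner ℝ u d ≤ 0) (x : EuclideanSpace ℝ (Fin n)) :
    f (x + d) ≤ f x := by
  refine le_of_forall_real fun s hs => ?_
  obtain ⟨r, hr, hrs⟩ := hp.exists_coe_of_le hs
  obtain ⟨a, b, ha, hab⟩ := exists_linear_lower_bound hp hl hc (x + d)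
  have hA : KerRecessionSymmetric (ContinuousLinearMap.id ℝ (EuclideanSpace ℝ (Fin n))) f := by
    intro e he _ y
    rw [show e = 0 from he, sub_zero]
  -- The proximal point `p` of `x + d` with parameter `k + 1` has subgradient `(k + 1)(x + d - p)`.
  -- Its pairing with `d` is nonpositive, so the subgradient inequality at `x` gives the bound,
  -- which forces `p → x + d`.
  have hprox : ∀ k : ℕ, ∃ p, ∃ q : ℝ, f p = q ∧ q + (k + 1) * ‖x + d - p‖ ^ 2 ≤ s := by
    intro k
    obtain ⟨p, hpm⟩ := exists_mem_argmin_proxObjective (w := x + d) hp hl hc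
      (Nat.cast_add_one_pos (α := ℝ) k) hA
    obtain ⟨q, hq, h⟩ := optimality_of_mem_argmin hp hc hpm
    have hsub : ((k : ℝ) + 1) • (x + d - p) ∈ ranSubdiff f := by
      refine ⟨p, (mem_subdiff_iff hp).2 ⟨q, hq, fun y t hy => ?_⟩⟩
      have h1 := h y t hy
      simp only [ContinuousLinearMap.id_apply] at h1
      rw [← neg_sub p (x + d), real_inner_smul_left, inner_neg_left]
      linarith
    have h2 := h x r hr.le
    have h3 := hd _ hsub
    refine ⟨p, q, hq, ?_⟩
    simp only [ContinuousLinearMap.id_apply] at h2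
    rw [← real_inner_self_eq_norm_sq]
    rw [real_inner_smul_left] at h3
    have e1 : inner ℝ (p - (x + d)) (x - p) =
        inner ℝ (x + d - p) d - inner ℝ (x + d - p) (x + d - p) := by
      rw [← inner_sub_right, ← neg_sub (x + d) p, inner_neg_left, ← inner_neg_right]
      congr 1
      abel
    rw [e1] at h2
    linarith
  choose p q hq hpq using hprox
  have hinv : Tendsto (fun k : ℕ => ((k : ℝ) + 1)⁻¹) atTop (𝓝 0) := by
    simpa using tendsto_one_div_add_atTop_nhds_zero_nat (𝕜 := ℝ)
  have hbound : ∀ k : ℕ, ‖x + d - p k‖ ^ 2 ≤ ((k : ℝ) + 1)⁻¹ * (2 * |s + b| + a ^ 2) := by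
    intro k
    have hk : (0 : ℝ) < k + 1 := Nat.cast_add_one_pos k
    have hk1 : (1 : ℝ) ≤ k + 1 := by linarith [Nat.cast_nonneg (α := ℝ) k]
    have h1 := hab _ _ (hq k).le
    have h2 := hpq k
    rw [norm_sub_rev] at h1
    set t := ‖x + d - p k‖
    have h3 : (k + 1) * t ^ 2 ≤ s + b + a * t := by linarith
    -- The linear term is absorbed by `a t ≤ (a² + t²) / 2`, leaving a bound independent of `k`.
    have h5 : (k + 1) * t ^ 2 ≤ 2 * |s + b| + a ^ 2 := by
      nlinarith [le_abs_self (s + b), sq_nonneg (a - t), mul_nonneg (sub_nonneg.2 hk1) (sq_nonneg t)]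
    calc t ^ 2 = ((k : ℝ) + 1)⁻¹ * ((k + 1) * t ^ 2) := by field_simp
      _ ≤ _ := by gcongr
  have hnorm : Tendsto (fun k => ‖x + d - p k‖ ^ 2) atTop (𝓝 0) := by
    refine squeeze_zero (fun k => sq_nonneg _) hbound ?_
    simpa using hinv.mul_const (2 * |s + b| + a ^ 2)
  have hnorm' : Tendsto (fun k => ‖p k - (x + d)‖) atTop (𝓝 0) := by
    have := hnorm.sqrt
    simpa [norm_sub_rev] using this
  refine le_coe_of_tendsto hl (tendsto_iff_norm_sub_tendsto_zero.2 hnorm')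
    (tendsto_const_nhds (x := s)) fun k => ?_
  rw [hq, EReal.coe_le_coe_iff]
  have hk : (0 : ℝ) < k + 1 := Nat.cast_add_one_pos k
  have : 0 ≤ ((k : ℝ) + 1) * ‖x + d - p k‖ ^ 2 := by positivity
  linarith [hpq k]

/-- Subgradients lie in the domain of the conjugate. -/
theorem ranSubdiff_subset_dom_conjugate (hp : IsProper f) :
    ranSubdiff f ⊆ dom (conjugate f) := by
  rintro u ⟨x, hu⟩
  obtain ⟨r, hr, h⟩ := (mem_subdiff_iff hp).1 hu
  refine lt_of_le_of_lt (b := ((inner ℝ u x - r : ℝ) : EReal)) (iSup_le fun y => ?_)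
    (EReal.coe_lt_top _)
  by_cases hy : f y < ⊤
  · obtain ⟨s, hs⟩ := hp.exists_coe hy
    have h1 := h y s hs.le
    rw [hs, ← EReal.coe_sub, EReal.coe_le_coe_iff]
    rw [inner_sub_right] at h1
    linarith
  · rw [not_lt_top_iff.1 hy, EReal.sub_top]
    exact bot_le

/-- Iterating a recession direction. -/
theorem le_of_recession_nsmul {d : EuclideanSpace ℝ (Fin n)} (hd : ∀ x, f (x + d) ≤ f x)
    (x : EuclideanSpace ℝ (Fin n)) (k : ℕ) : f (x + (k : ℝ) • d) ≤ f x := by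
  induction k with
  | zero => simp
  | succ k ih =>
    have e : x + ((k + 1 : ℕ) : ℝ) • d = x + (k : ℝ) • d + d := by push_cast; module
    rw [e]
    exact (hd _).trans ih

/-- Recession directions are polar to the domain of the conjugate. -/
theorem inner_nonpos_of_mem_dom_conjugate (hp : IsProper f) {d u : EuclideanSpace ℝ (Fin n)}
    (hd : ∀ x, f (x + d) ≤ f x) (hu : u ∈ dom (conjugate f)) : inner ℝ u d ≤ 0 := by
  obtain ⟨x, r, hr⟩ := hp.exists_point
  obtain ⟨c, hc, -⟩ := EReal.lt_iff_exists_real_btwn.1 (show conjugate f u < ⊤ from hu)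
  -- Fenchel's inequality along the ray `x + k d`, on which `f` stays below `r`; a positive slope is
  -- impossible.
  have key : ∀ k : ℕ, (k : ℝ) * inner ℝ u d ≤ c + r - inner ℝ u x := by
    intro k
    have h1 : f (x + (k : ℝ) • d) ≤ r := hr ▸ le_of_recession_nsmul hd x k
    obtain ⟨s, hs, hsr⟩ := hp.exists_coe_of_le h1
    have h2 := (le_iSup (fun x => ((inner ℝ u x : ℝ) : EReal) - f x) (x + (k : ℝ) • d)).trans hc.le
    simp only [hs, ← EReal.coe_sub, EReal.coe_le_coe_iff, inner_add_right,
      real_inner_smul_right] at h2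
    linarith
  by_contra hpos
  push Not at hpos
  obtain ⟨k, hk⟩ := exists_nat_gt ((c + r - inner ℝ u x) / inner ℝ u d)
  rw [div_lt_iff₀ hpos] at hk
  linarith [key k]

theorem recession_le_zero_iff (hp : IsProper f) {d : EuclideanSpace ℝ (Fin n)} :
    recession f d ≤ 0 ↔ ∀ x, f (x + d) ≤ f x := by
  unfold recession
  rw [iSup₂_le_iff]
  constructor
  · intro h x
    by_cases hx : f x < ⊤
    · obtain ⟨r, hr⟩ := hp.exists_coe hx
      have := h x hx
      rw [EReal.sub_nonpos] at this
      exact this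
    · rw [not_lt_top_iff.1 hx]; exact le_top
  · intro h x _
    rw [EReal.sub_nonpos]
    exact h x

variable {A : EuclideanSpace ℝ (Fin n) →L[ℝ] EuclideanSpace ℝ (Fin m)}

/-- Recession directions are polar to `dom f*`, so the hypothesis makes them orthogonal to all
subgradients; then `-d` also passes the test of `le_of_ranSubdiff_inner_nonpos`. This serves (B.1)
and (B.2). -/
theorem kerRecessionSymmetric_of_forall_ranSubdiff (hp : IsProper f)
    (hl : LowerSemicontinuous f) (hc : IsConvex f)
    (h : ∀ d, A d = 0 → (∀ u ∈ dom (conjugate f), inner ℝ u d ≤ 0) →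
      ∀ u ∈ ranSubdiff f, inner ℝ u d = 0) :
    KerRecessionSymmetric A f := by
  intro d hAd hd x
  rw [sub_eq_add_neg]
  refine le_of_ranSubdiff_inner_nonpos hp hl hc (fun u hu => ?_) x
  rw [inner_neg_right, h d hAd (fun u hu => inner_nonpos_of_mem_dom_conjugate hp hd hu) u hu,
    neg_zero]

theorem kerRecessionSymmetric_of_recession_pos (hp : IsProper f)
    (h : ∀ x ∈ {x | A x = 0} \
      {x | -(recession f (-x)) = recession f x ∧ recession f x = 0}, 0 < recession f x) :
    KerRecessionSymmetric A f := by
  intro d hAd hd x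
  have h0 : recession f d ≤ 0 := (recession_le_zero_iff hp).2 hd
  by_cases hmem : -(recession f (-d)) = recession f d ∧ recession f d = 0
  · have h1 : recession f (-d) = 0 := by
      rw [← neg_neg (recession f (-d)), hmem.1, hmem.2, neg_zero]
    rw [sub_eq_add_neg]
    exact (recession_le_zero_iff hp).1 h1.le x
  · exact absurd (h d ⟨hAd, hmem⟩) (not_lt.2 h0)

/-- The condition holds if zero is the only recession direction in the kernel. -/
theorem kerRecessionSymmetric_of_eq_zero
    (h : ∀ d, A d = 0 → (∀ x, f (x + d) ≤ f x) → d = 0) : KerRecessionSymmetric A f := by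
  intro d hAd hd x
  rw [h d hAd hd, sub_zero]

theorem IsCoercive.eq_zero_of_recession (hcoer : IsCoercive f) (hp : IsProper f)
    {d : EuclideanSpace ℝ (Fin n)} (hd : ∀ x, f (x + d) ≤ f x) : d = 0 := by
  by_contra hne
  obtain ⟨x, r, hr⟩ := hp.exists_point
  have hlim : Tendsto (fun k : ℕ => ‖x + (k : ℝ) • d‖) atTop atTop := by
    have h1 : Tendsto (fun k : ℕ => (k : ℝ) * ‖d‖ - ‖x‖) atTop atTop :=
      tendsto_atTop_add_const_right _ _
        (tendsto_natCast_atTop_atTop.atTop_mul_const (norm_pos_iff.2 hne))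
    refine tendsto_atTop_mono (fun k => ?_) h1
    have := norm_sub_le (x + (k : ℝ) • d) x
    rw [add_sub_cancel_left, norm_smul, Real.norm_natCast] at this
    linarith
  have h2 := hcoer.comp (tendsto_norm_atTop_iff_cobounded.1 hlim)
  have h3 : ∀ᶠ k : ℕ in atTop, (r : EReal) < f (x + (k : ℝ) • d) :=
    h2.eventually (lt_mem_nhds (EReal.coe_lt_top r))
  obtain ⟨k, hk⟩ := h3.exists
  exact absurd (hr ▸ le_of_recession_nsmul hd x k) (not_le.2 hk)

/-- At the midpoint of `x` and `x + k d`, strong convexity pushes `f` below `f x` by `α/8 · k²‖d‖²`,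
whereas `f` can decrease only linearly. -/
theorem IsStronglyConvex.eq_zero_of_recession (hs : IsStronglyConvex f) (hp : IsProper f)
    (hl : LowerSemicontinuous f) (hc : IsConvex f)
    {d : EuclideanSpace ℝ (Fin n)} (hd : ∀ x, f (x + d) ≤ f x) : d = 0 := by
  obtain ⟨α, hα, hs⟩ := hs
  obtain ⟨x, r, hr⟩ := hp.exists_point
  obtain ⟨a, b, ha, hab⟩ := exists_linear_lower_bound hp hl hc x
  have key : ∀ k : ℕ, (k : ℝ) * ((k : ℝ) * (α / 8 * ‖d‖ ^ 2) - a * ‖d‖ / 2) ≤ r + b := by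
    intro k
    have h1 : f (x + (k : ℝ) • d) ≤ r := hr ▸ le_of_recession_nsmul hd x k
    have h2 := hab _ _ (hs.le_coe hr.le h1 (t := 1 / 2) (by norm_num) (by norm_num))
    rw [add_sub_cancel_left, add_sub_cancel_left, sub_add_cancel_left, norm_neg, norm_smul,
      norm_smul, Real.norm_natCast] at h2
    norm_num at h2
    nlinarith
  by_contra hne
  have hpos : 0 < α / 8 * ‖d‖ ^ 2 := by have := norm_pos_iff.2 hne; positivity
  have hlim : Tendsto (fun k : ℕ => (k : ℝ) * ((k : ℝ) * (α / 8 * ‖d‖ ^ 2) - a * ‖d‖ / 2))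
      atTop atTop :=
    tendsto_natCast_atTop_atTop.atTop_mul_atTop₀ (tendsto_atTop_add_const_right _ _
      (tendsto_natCast_atTop_atTop.atTop_mul_const hpos))
  obtain ⟨k, hk⟩ := (hlim.eventually_gt_atTop (r + b)).exists
  exact absurd (key k) (not_le.2 hk)

end ADMM
end

/-! ### Critical points, saddle points and solutions -/

noncomputable section

namespace ADMM

variable {n m : ℕ} {f : EuclideanSpace ℝ (Fin n) → EReal} {g : EuclideanSpace ℝ (Fin m) → EReal}
  {M : Matrix (Fin m) (Fin n) ℝ}

/-- The map `app M` as a continuous linear map. -/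
def appL (M : Matrix (Fin m) (Fin n) ℝ) :
    EuclideanSpace ℝ (Fin n) →L[ℝ] EuclideanSpace ℝ (Fin m) :=
  LinearMap.toContinuousLinearMap (Matrix.toEuclideanLin M)

theorem appL_apply (x : EuclideanSpace ℝ (Fin n)) : appL M x = app M x := rfl

theorem app_sub (x y : EuclideanSpace ℝ (Fin n)) : app M (x - y) = app M x - app M y :=
  map_sub (appL M) x y

theorem inner_app_transpose (y : EuclideanSpace ℝ (Fin m)) (x : EuclideanSpace ℝ (Fin n)) :
    inner ℝ (app M.transpose y) x = inner ℝ y (app M x) := by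
  simp only [app, EuclideanSpace.inner_eq_star_dotProduct, star_trivial]
  rw [Matrix.dotProduct_mulVec, Matrix.vecMul_transpose]

/-- The subgradient inequalities that characterize critical points, in terms of epigraphs. -/
def IsKKT (f : EuclideanSpace ℝ (Fin n) → EReal) (g : EuclideanSpace ℝ (Fin m) → EReal)
    (M : Matrix (Fin m) (Fin n) ℝ)
    (x : EuclideanSpace ℝ (Fin n)) (z y : EuclideanSpace ℝ (Fin m)) : Prop :=
  app M x = z ∧
    (∃ a : ℝ, f x = a ∧ ∀ x' (s : ℝ), f x' ≤ s → a - inner ℝ y (app M x' - app M x) ≤ s) ∧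
    ∃ b : ℝ, g z = b ∧ ∀ z' (s : ℝ), g z' ≤ s → b + inner ℝ y (z' - z) ≤ s

/-- The Fréchet subdifferential of a convex function is its convex subdifferential. -/
theorem mem_frechetSubdiff_iff (hp : IsProper g) (hc : IsConvex g)
    {z u : EuclideanSpace ℝ (Fin m)} :
    u ∈ frechetSubdiff g z ↔
      ∃ b : ℝ, g z = b ∧ ∀ z' (s : ℝ), g z' ≤ s → b + inner ℝ u (z' - z) ≤ s := by
  constructor
  · rintro ⟨hz, h⟩
    obtain ⟨b, hb⟩ := hp.exists_coe hz
    refine ⟨b, hb, fun w s hs => ?_⟩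
    rcases eq_or_ne w z with rfl | hwz
    · rw [sub_self, inner_zero_right, add_zero]
      rwa [hb, EReal.coe_le_coe_iff] at hs
    have hpos : 0 < ‖w - z‖ := norm_pos_iff.2 (sub_ne_zero.2 hwz)
    refine le_of_forall_pos_le_add fun ε hε => ?_
    -- This slack, multiplied by the step length `t‖w - z‖`, is exactly `tε`; convexity along the
    -- segment then allows division by `t`.
    have hneg : ((-(ε / ‖w - z‖) : ℝ) : EReal) < 0 := by
      rw [← EReal.coe_zero, EReal.coe_lt_coe_iff, neg_lt_zero]
      positivity
    have hev := eventually_lt_of_lt_liminf (hneg.trans_le h)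
    have hcont : Tendsto (fun t : ℝ => z + t • (w - z)) (𝓝[>] 0) (𝓝[≠] z) := by
      refine tendsto_nhdsWithin_iff.2 ⟨?_, ?_⟩
      · have : Tendsto (fun t : ℝ => z + t • (w - z)) (𝓝 0) (𝓝 (z + (0 : ℝ) • (w - z))) :=
          (tendsto_id.smul_const _).const_add _
        rw [zero_smul, add_zero] at this
        exact this.mono_left nhdsWithin_le_nhds
      · filter_upwards [self_mem_nhdsWithin] with t ht
        simpa [sub_eq_zero, hwz] using (ne_of_gt ht)
    obtain ⟨t, ht, ht0, ht1⟩ := ((hcont.eventually hev).and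
      (Ioc_mem_nhdsGT (zero_lt_one' ℝ))).exists
    obtain ⟨c, hcz, hcs⟩ := hp.exists_coe_of_le (hc.le_coe hb.le hs ht0.le ht1)
    have hnorm : 0 < ‖z + t • (w - z) - z‖ := by
      rw [add_sub_cancel_left, norm_smul, Real.norm_of_nonneg ht0.le]; positivity
    rw [hcz, hb, ← EReal.coe_sub, ← EReal.coe_sub, ← EReal.coe_div, EReal.coe_lt_coe_iff,
      lt_div_iff₀ hnorm, add_sub_cancel_left, norm_smul, Real.norm_of_nonneg ht0.le,
      real_inner_smul_right] at ht
    have e : -(ε / ‖w - z‖) * (t * ‖w - z‖) = -(t * ε) := by field_simp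
    rw [e] at ht
    have h2 : t * (b + inner ℝ u (w - z)) ≤ t * (s + ε) := by linarith
    exact le_of_mul_le_mul_left h2 ht0
  · rintro ⟨b, hb, h⟩
    refine ⟨show g z < ⊤ by rw [hb]; exact EReal.coe_lt_top b, ?_⟩
    refine le_liminf_of_le (by isBoundedDefault) (Eventually.of_forall fun w => ?_)
    refine EReal.div_nonneg ?_ (EReal.coe_nonneg.2 (norm_nonneg _))
    by_cases hw : g w < ⊤
    · obtain ⟨s, hs⟩ := hp.exists_coe hw
      rw [hs, hb, ← EReal.coe_sub, ← EReal.coe_sub]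
      exact EReal.coe_nonneg.2 (by linarith [h w s hs.le])
    · rw [not_lt_top_iff.1 hw, hb, EReal.top_sub_coe, EReal.top_sub_coe]
      exact le_top

theorem isCriticalPoint_iff_isKKT (hf : IsProper f) (hg : IsProper g) (hgc : IsConvex g)
    {x : EuclideanSpace ℝ (Fin n)} {z y : EuclideanSpace ℝ (Fin m)} :
    IsCriticalPoint f g M x z y ↔ IsKKT f g M x z y := by
  unfold IsCriticalPoint IsKKT
  rw [mem_subdiff_iff hf, mem_frechetSubdiff_iff hg hgc, sub_eq_zero]
  have e : ∀ x', inner ℝ (-(app M.transpose y)) (x' - x) = -inner ℝ y (app M x' - app M x) := by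
    intro x'
    rw [inner_neg_left, inner_app_transpose, app_sub]
  simp only [e, ← sub_eq_add_neg]
  tauto

theorem isSaddlePoint_of_isKKT (hf : IsProper f) (hg : IsProper g)
    {x : EuclideanSpace ℝ (Fin n)} {z y : EuclideanSpace ℝ (Fin m)} (h : IsKKT f g M x z y) :
    IsSaddlePoint f g M x z y := by
  obtain ⟨hM, ⟨a, ha, hfa⟩, b, hb, hgb⟩ := h
  have h0 : ∀ y', lagrangian f g M 0 x z y' = ((a + b : ℝ) : EReal) := by
    intro y'
    simp [lagrangian, hM, ha, hb]
  refine ⟨fun y' => by rw [h0, h0], fun x' z' => ?_⟩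
  rw [h0, lagrangian]
  by_cases hx : f x' < ⊤
  · by_cases hz : g z' < ⊤
    · obtain ⟨r, hr⟩ := hf.exists_coe hx
      obtain ⟨s, hs⟩ := hg.exists_coe hz
      rw [hr, hs, ← EReal.coe_add, ← EReal.coe_add, EReal.coe_le_coe_iff]
      have h1 := hfa x' r hr.le
      have h2 := hgb z' s hs.le
      have e : inner ℝ y (app M x' - z') =
          inner ℝ y (app M x' - app M x) - inner ℝ y (z' - z) := by
        rw [← inner_sub_right, hM, sub_sub_sub_cancel_right]
      rw [e]
      linarith
    · rw [not_lt_top_iff.1 hz, EReal.add_top_of_ne_bot (hf.1 x'), EReal.top_add_coe]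
      exact le_top
  · rw [not_lt_top_iff.1 hx, EReal.top_add_of_ne_bot (hg.1 z'), EReal.top_add_coe]
    exact le_top

/-- Maximality in `y` forces feasibility; minimality, with one of `x`, `z` held fixed, gives the two
subgradient inequalities. -/
theorem isKKT_of_isSaddlePoint (hf : IsProper f) (hg : IsProper g)
    {x : EuclideanSpace ℝ (Fin n)} {z y : EuclideanSpace ℝ (Fin m)}
    (h : IsSaddlePoint f g M x z y) : IsKKT f g M x z y := by
  obtain ⟨h1, h2⟩ := h
  obtain ⟨x₀, r₀, hr₀⟩ := hf.exists_point
  obtain ⟨z₀, s₀, hs₀⟩ := hg.exists_point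
  have hlt : lagrangian f g M 0 x z y < ⊤ := by
    refine (h2 x₀ z₀).trans_lt ?_
    rw [lagrangian, hr₀, hs₀, ← EReal.coe_add, ← EReal.coe_add]
    exact EReal.coe_lt_top _
  have hx : f x < ⊤ := by
    by_contra hx
    rw [lagrangian, not_lt_top_iff.1 hx, EReal.top_add_of_ne_bot (hg.1 z),
      EReal.top_add_coe] at hlt
    exact lt_irrefl _ hlt
  have hz : g z < ⊤ := by
    by_contra hz
    rw [lagrangian, not_lt_top_iff.1 hz, EReal.add_top_of_ne_bot (hf.1 x),
      EReal.top_add_coe] at hlt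
    exact lt_irrefl _ hlt
  obtain ⟨a, ha⟩ := hf.exists_coe hx
  obtain ⟨b, hb⟩ := hg.exists_coe hz
  have hM : app M x = z := by
    -- Moving the multiplier along the residual raises the Lagrangian by the squared residual.
    have h3 := h1 (y + (app M x - z))
    simp only [lagrangian, ha, hb, ← EReal.coe_add, EReal.coe_le_coe_iff, inner_add_left,
      real_inner_self_eq_norm_sq] at h3
    have h4 : ‖app M x - z‖ ^ 2 = 0 := le_antisymm (by linarith) (sq_nonneg _)
    exact sub_eq_zero.1 (norm_eq_zero.1 (pow_eq_zero_iff two_ne_zero |>.1 h4))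
  refine ⟨hM, ⟨a, ha, fun x' s hs => ?_⟩, b, hb, fun z' s hs => ?_⟩
  · obtain ⟨r, hr, hrs⟩ := hf.exists_coe_of_le hs
    have h3 := h2 x' z
    simp only [lagrangian, ha, hb, hr, ← EReal.coe_add, EReal.coe_le_coe_iff, hM, sub_self,
      inner_zero_right, zero_div, zero_mul] at h3
    rw [hM]
    linarith
  · obtain ⟨r, hr, hrs⟩ := hg.exists_coe_of_le hs
    have h3 := h2 x z'
    simp only [lagrangian, ha, hb, hr, ← EReal.coe_add, EReal.coe_le_coe_iff, hM, sub_self,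
      inner_zero_right, zero_div, zero_mul] at h3
    rw [← neg_sub z' z, inner_neg_right] at h3
    linarith

theorem isSaddlePoint_iff_isCriticalPoint (hf : IsProper f) (hg : IsProper g)
    (hgc : IsConvex g) {x : EuclideanSpace ℝ (Fin n)} {z y : EuclideanSpace ℝ (Fin m)} :
    IsSaddlePoint f g M x z y ↔ IsCriticalPoint f g M x z y := by
  rw [isCriticalPoint_iff_isKKT hf hg hgc]
  exact ⟨isKKT_of_isSaddlePoint hf hg, isSaddlePoint_of_isKKT hf hg⟩

theorem IsKKT.isSolution (hf : IsProper f) (hg : IsProper g)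
    {x : EuclideanSpace ℝ (Fin n)} {z y : EuclideanSpace ℝ (Fin m)} (h : IsKKT f g M x z y) :
    IsSolution f g M x z := by
  have hs := (isSaddlePoint_of_isKKT hf hg h).2
  obtain ⟨hM, ⟨a, ha, -⟩, b, hb, -⟩ := h
  refine ⟨hM, by rw [ha, hb, ← EReal.coe_add]; exact EReal.coe_lt_top _, fun x' z' h' => ?_⟩
  have := hs x' z'
  simpa [lagrangian, hM, h'] using this

/-! ### Multipliers by extension of a positive functional -/

/-- Strong duality under the relative interior constraint qualification. -/
theorem exists_isSaddlePoint_of_isSolution (hf : IsProper f) (hg : IsProper g)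
    (hfc : IsConvex f) (hgc : IsConvex g)
    {x : EuclideanSpace ℝ (Fin n)} {z : EuclideanSpace ℝ (Fin m)} (h : IsSolution f g M x z)
    (hri : 0 ∈ intrinsicInterior ℝ (dom g - app M '' dom f)) :
    ∃ y, IsSaddlePoint f g M x z y := by
  obtain ⟨hM, hfin, hmin⟩ := h
  have hx : f x < ⊤ := by
    by_contra hx
    rw [not_lt_top_iff.1 hx, EReal.top_add_of_ne_bot (hg.1 z)] at hfin
    exact lt_irrefl _ hfin
  have hz : g z < ⊤ := by
    by_contra hz
    rw [not_lt_top_iff.1 hz, EReal.add_top_of_ne_bot (hf.1 x)] at hfin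
    exact lt_irrefl _ hfin
  obtain ⟨a, ha⟩ := hf.exists_coe hx
  obtain ⟨b, hb⟩ := hg.exists_coe hz
  set S := dom g - app M '' dom f with hS
  set V := (affineSpan ℝ S).direction with hV
  have h0S : (0 : EuclideanSpace ℝ (Fin m)) ∈ S := intrinsicInterior_subset hri
  have hSV : ∀ x' z' (r s : ℝ), f x' ≤ r → g z' ≤ s → z' - app M x' ∈ V := by
    intro x' z' r s hr hs
    have hmem : z' - app M x' ∈ S :=
      Set.sub_mem_sub (hs.trans_lt (EReal.coe_lt_top s))
        (Set.mem_image_of_mem _ (hr.trans_lt (EReal.coe_lt_top r)))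
    have := AffineSubspace.vsub_mem_direction (subset_affineSpan ℝ S hmem)
      (subset_affineSpan ℝ S h0S)
    simpa using this
  -- The cone generated by constraint defects paired with bounds on the excess over the optimal
  -- value. It lives over `V`, since only a relative interior is available.
  let K : PointedCone ℝ (V × ℝ) :=
    { carrier := {p | ∃ (t : ℝ) (x' : EuclideanSpace ℝ (Fin n)) (z' : EuclideanSpace ℝ (Fin m))
        (r s : ℝ), 0 ≤ t ∧ f x' ≤ r ∧ g z' ≤ s ∧
        (p.1 : EuclideanSpace ℝ (Fin m)) = t • (z' - app M x') ∧ p.2 = t * (r + s - (a + b))}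
      zero_mem' := ⟨0, x, z, a, b, le_rfl, ha.le, hb.le, by simp, by simp⟩
      smul_mem' := by
        rintro c p ⟨t, x', z', r, s, ht, hr, hs, h1, h2⟩
        refine ⟨c * t, x', z', r, s, mul_nonneg c.2 ht, hr, hs, ?_, ?_⟩
        · rw [mul_smul, ← h1]; rfl
        · rw [mul_assoc, ← h2]; rfl
      add_mem' := by
        rintro p q ⟨t, x₁, z₁, r₁, s₁, ht, hr₁, hs₁, h1, h2⟩ ⟨τ, x₂, z₂, r₂, s₂, hτ, hr₂, hs₂, h3, h4⟩
        rcases (add_nonneg ht hτ).eq_or_lt with h0 | hpos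
        · have ht0 : t = 0 := by linarith
          have hτ0 : τ = 0 := by linarith
          subst ht0 hτ0
          refine ⟨0, x, z, a, b, le_rfl, ha.le, hb.le, ?_, ?_⟩
          · simp [h1, h3]
          · simp [h2, h4]
        · have hq0 : 0 ≤ τ / (t + τ) := by positivity
          have hq1 : τ / (t + τ) ≤ 1 := (div_le_one hpos).2 (by linarith)
          refine ⟨t + τ, _, _, _, _, hpos.le, hfc.le_coe hr₁ hr₂ hq0 hq1,
            hgc.le_coe hs₁ hs₂ hq0 hq1, ?_, ?_⟩
          · have e : app M (x₁ + (τ / (t + τ)) • (x₂ - x₁)) =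
                app M x₁ + (τ / (t + τ)) • (app M x₂ - app M x₁) := by
              simp only [← appL_apply, map_add, map_smul, map_sub]
            rw [e, Prod.fst_add, Submodule.coe_add, h1, h3]
            have e2 : (t + τ) • (z₁ + (τ / (t + τ)) • (z₂ - z₁) -
                (app M x₁ + (τ / (t + τ)) • (app M x₂ - app M x₁))) =
                (t + τ) • (z₁ - app M x₁) +
                  ((t + τ) * (τ / (t + τ))) • ((z₂ - app M x₂) - (z₁ - app M x₁)) := by module
            rw [e2, mul_div_cancel₀ _ hpos.ne']
            module
          · rw [Prod.snd_add, h2, h4]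
            field_simp
            ring }
  -- The second coordinate on `{0} × ℝ`; its positivity on `K` is the optimality of `(x, z)`.
  let F : (V × ℝ) →ₗ.[ℝ] ℝ :=
    ⟨LinearMap.ker (LinearMap.fst ℝ V ℝ), (LinearMap.snd ℝ V ℝ).comp (Submodule.subtype _)⟩
  obtain ⟨G, hGF, hGK⟩ := riesz_extension K F (by
      rintro ⟨⟨v, ρ⟩, hv⟩ ⟨t, x', z', r, s, ht, hr, hs, h1, h2⟩
      have hv0 : v = 0 := hv
      subst hv0
      show 0 ≤ ρ
      have h2' : ρ = t * (r + s - (a + b)) := h2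
      have h1' : (0 : EuclideanSpace ℝ (Fin m)) = t • (z' - app M x') := h1
      rw [h2']
      rcases ht.eq_or_lt with rfl | htpos
      · simp
      · have h3 : app M x' = z' := by
          have := (smul_eq_zero.1 h1'.symm).resolve_left htpos.ne'
          exact (sub_eq_zero.1 this).symm
        have h4 := (hmin x' z' h3).trans (add_le_add hr hs)
        rw [ha, hb, ← EReal.coe_add, ← EReal.coe_add, EReal.coe_le_coe_iff] at h4
        exact mul_nonneg ht (by linarith)) (by
      rintro ⟨v, ρ⟩
      -- The cofinality needed for the extension: a small multiple of any `v` is an attainable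
      -- defect, so a vertical shift brings `(v, ρ)` into `K`.
      obtain ⟨ε, hε, hmem⟩ := exists_pos_add_smul_mem hri v.2
      rw [zero_add] at hmem
      obtain ⟨z', hz', _, ⟨x', hx', rfl⟩, he⟩ := Set.mem_sub.1 hmem
      obtain ⟨r, hr⟩ := hf.exists_coe hx'
      obtain ⟨s, hs⟩ := hg.exists_coe hz'
      refine ⟨⟨(0, ε⁻¹ * (r + s - (a + b)) - ρ), rfl⟩, ε⁻¹, x', z', r, s, by positivity,
        hr.le, hs.le, ?_, ?_⟩
      · rw [he, smul_smul, inv_mul_cancel₀ hε.ne', one_smul]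
        simp
      · simp)
  let ℓ : V →L[ℝ] ℝ := LinearMap.toContinuousLinearMap (-(G.comp (LinearMap.inl ℝ V ℝ)))
  set y := (InnerProductSpace.toDual ℝ V).symm ℓ with hy
  refine ⟨y, isSaddlePoint_of_isKKT hf hg ?_⟩
  have hmain : ∀ x' z' (r s : ℝ), f x' ≤ r → g z' ≤ s →
      a + b + inner ℝ (y : EuclideanSpace ℝ (Fin m)) (z' - app M x') ≤ r + s := by
    intro x' z' r s hr hs
    have hv := hSV x' z' r s hr hs
    have h1 : 0 ≤ G (⟨z' - app M x', hv⟩, r + s - (a + b)) :=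
      hGK _ ⟨1, x', z', r, s, zero_le_one, hr, hs, by simp, by simp⟩
    have h2 : G (⟨z' - app M x', hv⟩, r + s - (a + b)) =
        G (⟨z' - app M x', hv⟩, 0) + G (0, r + s - (a + b)) := by
      rw [← map_add]; simp
    have h3 : G (0, r + s - (a + b)) = r + s - (a + b) := hGF ⟨(0, r + s - (a + b)), rfl⟩
    have h4 : inner ℝ y (⟨z' - app M x', hv⟩ : V) = -G (⟨z' - app M x', hv⟩, 0) := by
      rw [hy, InnerProductSpace.toDual_symm_apply]
      rfl
    rw [Submodule.coe_inner] at h4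
    rw [h4]
    linarith
  refine ⟨hM, ⟨a, ha, fun x' r hr => ?_⟩, b, hb, fun z' s hs => ?_⟩
  · have h1 := hmain x' z r b hr hb.le
    rw [← hM, ← neg_sub (app M x') (app M x), inner_neg_right] at h1
    linarith
  · have h1 := hmain x z' a s ha.le hs
    rw [hM] at h1
    linarith

end ADMM
end

/-! ### The ADMM steps as proximal steps -/

noncomputable section

namespace ADMM

variable {n m : ℕ} {f : EuclideanSpace ℝ (Fin n) → EReal} {g : EuclideanSpace ℝ (Fin m) → EReal}
  {M : Matrix (Fin m) (Fin n) ℝ} {γ : ℝ}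

theorem xStep_eq (z y : EuclideanSpace ℝ (Fin m)) :
    xStep f M γ z y = argmin (proxObjective f (appL M) γ (z - (1 / γ) • y)) := by
  unfold xStep proxObjective
  simp only [appL_apply, sub_sub_eq_add_sub, add_sub_right_comm]

theorem zStep_eq (x : EuclideanSpace ℝ (Fin n)) (y : EuclideanSpace ℝ (Fin m)) :
    zStep g M γ x y = argmin (proxObjective g (ContinuousLinearMap.id ℝ _) γ
      (app M x + (1 / γ) • y)) := by
  unfold zStep proxObjective
  congr 1
  funext z
  rw [ContinuousLinearMap.id_apply, norm_sub_rev z, add_sub_right_comm]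

theorem kerRecessionSymmetric_id {k : ℕ} {h : EuclideanSpace ℝ (Fin k) → EReal} :
    KerRecessionSymmetric (ContinuousLinearMap.id ℝ (EuclideanSpace ℝ (Fin k))) h :=
  kerRecessionSymmetric_of_eq_zero fun _ hd _ => hd

theorem xStep_nonempty (hp : IsProper f) (hl : LowerSemicontinuous f) (hc : IsConvex f)
    (hγ : 0 < γ) (hA : KerRecessionSymmetric (appL M) f) (z y : EuclideanSpace ℝ (Fin m)) :
    (xStep f M γ z y).Nonempty := by
  rw [xStep_eq]
  exact exists_mem_argmin_proxObjective hp hl hc hγ hA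

/-- The `z`-step is a proximal step for the identity map: its kernel is trivial, and
nonexpansiveness with equal data gives uniqueness. -/
theorem zStep_existsUnique (hp : IsProper g) (hl : LowerSemicontinuous g) (hc : IsConvex g)
    (hγ : 0 < γ) (x : EuclideanSpace ℝ (Fin n)) (y : EuclideanSpace ℝ (Fin m)) :
    ∃! z, z ∈ zStep g M γ x y := by
  rw [zStep_eq]
  obtain ⟨z, hz⟩ := exists_mem_argmin_proxObjective hp hl hc hγ kerRecessionSymmetric_id
  refine ⟨z, hz, fun z' hz' => ?_⟩
  have h := norm_sub_le_of_mem_argmin hp hc hγ hz' hz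
  rw [sub_self, norm_zero] at h
  exact sub_eq_zero.1 (norm_le_zero_iff.1 h)

theorem xStep_nonexpansive (hp : IsProper f) (hc : IsConvex f) (hγ : 0 < γ)
    {x x' : EuclideanSpace ℝ (Fin n)} {z y z' y' : EuclideanSpace ℝ (Fin m)}
    (hx : x ∈ xStep f M γ z y) (hx' : x' ∈ xStep f M γ z' y') :
    ‖app M x - app M x'‖ ≤ ‖(z - (1 / γ) • y) - (z' - (1 / γ) • y')‖ := by
  rw [xStep_eq] at hx hx'
  have h := norm_sub_le_of_mem_argmin hp hc hγ hx hx'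
  rwa [appL_apply, appL_apply] at h

theorem zStep_nonexpansive (hp : IsProper g) (hc : IsConvex g) (hγ : 0 < γ)
    {x x' : EuclideanSpace ℝ (Fin n)} {z y z' y' : EuclideanSpace ℝ (Fin m)}
    (hz : z ∈ zStep g M γ x y) (hz' : z' ∈ zStep g M γ x' y') :
    ‖z - z'‖ ≤ ‖(app M x + (1 / γ) • y) - (app M x' + (1 / γ) • y')‖ := by
  rw [zStep_eq] at hz hz'
  have h := norm_sub_le_of_mem_argmin hp hc hγ hz hz'
  rwa [ContinuousLinearMap.id_apply, ContinuousLinearMap.id_apply] at h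

/-- The multiplier here contains the old `z`, so along the iteration it differs from the updated `y`
by `γ` times the increment of `z`. -/
theorem xStep_optimality (hp : IsProper f) (hc : IsConvex f) (hγ : 0 < γ)
    {x : EuclideanSpace ℝ (Fin n)} {z y : EuclideanSpace ℝ (Fin m)} (hx : x ∈ xStep f M γ z y) :
    ∃ r : ℝ, f x = r ∧ ∀ w (s : ℝ), f w ≤ s →
      r - inner ℝ (y + γ • (app M x - z)) (app M w - app M x) ≤ s := by
  rw [xStep_eq] at hx
  obtain ⟨r, hr, h⟩ := optimality_of_mem_argmin hp hc hx
  refine ⟨r, hr, fun w s hs => ?_⟩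
  have e : y + γ • (app M x - z) = γ • (app M x - (z - (1 / γ) • y)) := by
    rw [← sub_add, smul_add, smul_smul, mul_one_div_cancel hγ.ne', one_smul, add_comm]
  rw [e, real_inner_smul_left]
  exact h w s hs

theorem zStep_optimality (hp : IsProper g) (hc : IsConvex g) (hγ : 0 < γ)
    {x : EuclideanSpace ℝ (Fin n)} {z y : EuclideanSpace ℝ (Fin m)} (hz : z ∈ zStep g M γ x y) :
    ∃ r : ℝ, g z = r ∧ ∀ w (s : ℝ), g w ≤ s →
      r + inner ℝ (y + γ • (app M x - z)) (w - z) ≤ s := by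
  rw [zStep_eq] at hz
  obtain ⟨r, hr, h⟩ := optimality_of_mem_argmin hp hc hz
  refine ⟨r, hr, fun w s hs => ?_⟩
  have e : y + γ • (app M x - z) = -(γ • (z - (app M x + (1 / γ) • y))) := by
    rw [← smul_neg, neg_sub, add_sub_right_comm, smul_add, smul_smul,
      mul_one_div_cancel hγ.ne', one_smul, add_comm]
  rw [e, inner_neg_left, real_inner_smul_left]
  exact h w s hs

/-! ### Energy decrease and convergence -/

/-- The Lyapunov function of the iteration. -/
def energy (γ : ℝ) (zs ys z y : EuclideanSpace ℝ (Fin m)) : ℝ :=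
  γ * ‖z - zs‖ ^ 2 + γ⁻¹ * ‖y - ys‖ ^ 2

theorem energy_nonneg (hγ : 0 < γ) (zs ys z y : EuclideanSpace ℝ (Fin m)) :
    0 ≤ energy γ zs ys z y := by
  unfold energy; positivity

/-- Here `p`, `q` are the errors in `z`, `y`. Expanding `h1` and dropping the nonnegative products
`h2`, `h3` leaves two terms that polarization turns into differences of squares. -/
theorem energy_decrease_aux {E : Type*} [NormedAddCommGroup E] [InnerProductSpace ℝ E]
    (hγ : 0 < γ) {p q p' q' : E}
    (h1 : inner ℝ (q' + γ • (p' - p)) (p' + γ⁻¹ • (q' - q)) ≤ 0)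
    (h2 : 0 ≤ inner ℝ q' p') (h3 : 0 ≤ inner ℝ (q' - q) (p' - p)) :
    γ * ‖p'‖ ^ 2 + γ⁻¹ * ‖q'‖ ^ 2 + γ * ‖p' - p‖ ^ 2 + γ⁻¹ * ‖q' - q‖ ^ 2 ≤
      γ * ‖p‖ ^ 2 + γ⁻¹ * ‖q‖ ^ 2 := by
  have e1 : inner ℝ (q' + γ • (p' - p)) (p' + γ⁻¹ • (q' - q)) =
      inner ℝ q' p' + γ⁻¹ * inner ℝ q' (q' - q) + γ * inner ℝ p' (p' - p) +
        inner ℝ (q' - q) (p' - p) := by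
    simp only [inner_add_left, inner_add_right, real_inner_smul_left, real_inner_smul_right]
    rw [real_inner_comm p' (p' - p), real_inner_comm (q' - q) (p' - p), ← mul_assoc,
      inv_mul_cancel₀ hγ.ne']
    ring
  have e2 : ∀ u v : E, 2 * inner ℝ u (u - v) = ‖u‖ ^ 2 + ‖u - v‖ ^ 2 - ‖v‖ ^ 2 := by
    intro u v
    rw [norm_sub_sq_real, inner_sub_right, real_inner_self_eq_norm_sq]
    ring
  have e3 := congrArg (γ * ·) (e2 p' p)
  have e4 := congrArg (γ⁻¹ * ·) (e2 q' q)
  rw [e1] at h1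
  linarith

variable {x : ℕ → EuclideanSpace ℝ (Fin n)} {z y : ℕ → EuclideanSpace ℝ (Fin m)}

theorem IsADMMSequence.app_eq (h : IsADMMSequence f g M γ x z y) (hγ : 0 < γ) (k : ℕ) :
    app M (x (k + 1)) = z (k + 1) + γ⁻¹ • (y (k + 1) - y k) := by
  rw [(h k).2.2, add_sub_cancel_left, smul_smul, inv_mul_cancel₀ hγ.ne', one_smul,
    add_sub_cancel]

theorem IsADMMSequence.y_mem (h : IsADMMSequence f g M γ x z y) (hp : IsProper g)
    (hc : IsConvex g) (hγ : 0 < γ) (k : ℕ) :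
    ∃ r : ℝ, g (z (k + 1)) = r ∧ ∀ w (s : ℝ), g w ≤ s →
      r + inner ℝ (y (k + 1)) (w - z (k + 1)) ≤ s := by
  rw [(h k).2.2]
  exact zStep_optimality hp hc hγ (h k).2.1

/-- The three inputs are monotonicity for `f` against the KKT point, for `g` against the KKT point,
and for `g` between consecutive iterates. The last starts at index `1`, since the arbitrary `y 0`
need not be a subgradient at `z 0`. -/
theorem IsADMMSequence.energy_decrease (h : IsADMMSequence f g M γ x z y)
    (hf : IsProper f) (hfc : IsConvex f) (hg : IsProper g) (hgc : IsConvex g) (hγ : 0 < γ)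
    {xs : EuclideanSpace ℝ (Fin n)} {zs ys : EuclideanSpace ℝ (Fin m)}
    (hs : IsKKT f g M xs zs ys) (k : ℕ) :
    energy γ zs ys (z (k + 2)) (y (k + 2)) + γ * ‖z (k + 2) - z (k + 1)‖ ^ 2 +
      γ⁻¹ * ‖y (k + 2) - y (k + 1)‖ ^ 2 ≤ energy γ zs ys (z (k + 1)) (y (k + 1)) := by
  obtain ⟨hM, ⟨a, ha, hfa⟩, b, hb, hgb⟩ := hs
  obtain ⟨r, hr, hx⟩ := xStep_optimality hf hfc hγ (h (k + 1)).1
  obtain ⟨s₁, hs₁, hz₁⟩ := h.y_mem hg hgc hγ k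
  obtain ⟨s₂, hs₂, hz₂⟩ := h.y_mem hg hgc hγ (k + 1)
  have hMx := h.app_eq hγ (k + 1)
  simp only [add_assoc, Nat.reduceAdd] at *
  have f1 := hfa _ _ hr.le
  have f2 := hx _ _ ha.le
  have g1 := hgb _ _ hs₂.le
  have g2 := hz₂ _ _ hb.le
  have g3 := hz₁ _ _ hs₂.le
  have g4 := hz₂ _ _ hs₁.le
  have key := energy_decrease_aux hγ (p := z (k + 1) - zs) (q := y (k + 1) - ys)
    (p' := z (k + 2) - zs) (q' := y (k + 2) - ys) ?_ ?_ ?_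
  · rw [sub_sub_sub_cancel_right, sub_sub_sub_cancel_right] at key
    unfold energy
    linarith
  · have e1 : y (k + 2) - ys + γ • (z (k + 2) - zs - (z (k + 1) - zs)) =
        (y (k + 1) + γ • (app M (x (k + 2)) - z (k + 1))) - ys := by
      have e0 : y (k + 2) = y (k + 1) + γ • (app M (x (k + 2)) - z (k + 2)) := (h (k + 1)).2.2
      rw [e0]
      module
    have e2 : z (k + 2) - zs + γ⁻¹ • (y (k + 2) - ys - (y (k + 1) - ys)) =
        app M (x (k + 2)) - app M xs := by
      rw [hMx, hM, sub_sub_sub_cancel_right]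
      abel
    rw [e1, e2, inner_sub_left]
    rw [← neg_sub (app M (x (k + 2))) (app M xs), inner_neg_right] at f2
    linarith
  · rw [inner_sub_left]
    rw [← neg_sub (z (k + 2)) zs, inner_neg_right] at g2
    linarith
  · rw [sub_sub_sub_cancel_right, sub_sub_sub_cancel_right, inner_sub_left]
    rw [← neg_sub (z (k + 2)) (z (k + 1)), inner_neg_right] at g4
    linarith

theorem tendsto_zero_of_mul_norm_sq_le {ι E : Type*} [NormedAddCommGroup E] {l : Filter ι}
    {c : ℝ} (hc : 0 < c) {u : ι → E} {V : ι → ℝ} (hV : Tendsto V l (𝓝 0))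
    (h : ∀ i, c * ‖u i‖ ^ 2 ≤ V i) : Tendsto u l (𝓝 0) := by
  have h1 : Tendsto (fun i => ‖u i‖ ^ 2) l (𝓝 0) := by
    refine squeeze_zero (g := fun i => c⁻¹ * V i) (fun i => sq_nonneg _) (fun i => ?_) ?_
    · rw [le_inv_mul_iff₀ hc]; exact h i
    · simpa using hV.const_mul c⁻¹
  have h2 := h1.sqrt
  simp only [Real.sqrt_sq (norm_nonneg _), Real.sqrt_zero] at h2
  exact tendsto_zero_iff_norm_tendsto_zero.2 h2

/-- Convergence of the iteration when a point with the subgradient inequalities exists and the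
first step is solvable. -/
theorem IsADMMSequence.exists_tendsto (h : IsADMMSequence f g M γ x z y)
    (hf : IsProper f) (hfl : LowerSemicontinuous f) (hfc : IsConvex f)
    (hg : IsProper g) (hgl : LowerSemicontinuous g) (hgc : IsConvex g) (hγ : 0 < γ)
    (hA : KerRecessionSymmetric (appL M) f)
    (hs : ∃ xs zs ys, IsKKT f g M xs zs ys) :
    ∃ xs zs ys, IsKKT f g M xs zs ys ∧ Tendsto (fun k => app M (x k)) atTop (𝓝 (app M xs)) ∧
      Tendsto z atTop (𝓝 zs) ∧ Tendsto y atTop (𝓝 ys) := by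
  have hγ' : 0 < γ⁻¹ := inv_pos.2 hγ
  have hanti : ∀ {xs zs ys}, IsKKT f g M xs zs ys →
      Antitone fun k => energy γ zs ys (z (k + 1)) (y (k + 1)) := by
    intro xs zs ys hs
    refine antitone_nat_of_succ_le fun k => ?_
    have h1 := h.energy_decrease hf hfc hg hgc hγ hs k
    have h2 : 0 ≤ γ * ‖z (k + 2) - z (k + 1)‖ ^ 2 := by positivity
    have h3 : 0 ≤ γ⁻¹ * ‖y (k + 2) - y (k + 1)‖ ^ 2 := by positivity
    show energy γ zs ys (z (k + 2)) (y (k + 2)) ≤ _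
    linarith
  have hlimit : ∀ {xs zs ys}, IsKKT f g M xs zs ys →
      ∃ v, Tendsto (fun k => energy γ zs ys (z (k + 1)) (y (k + 1))) atTop (𝓝 v) := by
    intro xs zs ys hs
    refine ⟨_, tendsto_atTop_ciInf (hanti hs) ⟨0, ?_⟩⟩
    rintro _ ⟨k, rfl⟩
    exact energy_nonneg hγ _ _ _ _
  obtain ⟨x₀, z₀, y₀, h₀⟩ := hs
  obtain ⟨v, hv⟩ := hlimit h₀
  have hdiff : Tendsto (fun k => energy γ z₀ y₀ (z (k + 1)) (y (k + 1)) -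
      energy γ z₀ y₀ (z (k + 2)) (y (k + 2))) atTop (𝓝 0) := by
    have h1 := hv.sub (hv.comp (tendsto_add_atTop_nat 1))
    rw [sub_self] at h1
    exact h1
  have hdz : Tendsto (fun k => z (k + 2) - z (k + 1)) atTop (𝓝 0) := by
    refine tendsto_zero_of_mul_norm_sq_le hγ hdiff fun k => ?_
    have h1 := h.energy_decrease hf hfc hg hgc hγ h₀ k
    have h3 : 0 ≤ γ⁻¹ * ‖y (k + 2) - y (k + 1)‖ ^ 2 := by positivity
    linarith
  have hdy : Tendsto (fun k => y (k + 2) - y (k + 1)) atTop (𝓝 0) := by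
    refine tendsto_zero_of_mul_norm_sq_le hγ' hdiff fun k => ?_
    have h1 := h.energy_decrease hf hfc hg hgc hγ h₀ k
    have h3 : 0 ≤ γ * ‖z (k + 2) - z (k + 1)‖ ^ 2 := by positivity
    linarith
  have hbz : ∀ k, z (k + 1) ∈ Metric.closedBall z₀ (√(γ⁻¹ * energy γ z₀ y₀ (z 1) (y 1))) := by
    intro k
    rw [mem_closedBall_iff_norm]
    refine Real.le_sqrt_of_sq_le ?_
    rw [le_inv_mul_iff₀ hγ]
    have h1 : energy γ z₀ y₀ (z (k + 1)) (y (k + 1)) ≤ _ := hanti h₀ (Nat.zero_le k)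
    have h2 : 0 ≤ γ⁻¹ * ‖y (k + 1) - y₀‖ ^ 2 := by positivity
    refine le_trans ?_ h1
    unfold energy
    linarith
  have hby : ∀ k, y (k + 1) ∈ Metric.closedBall y₀ (√(γ * energy γ z₀ y₀ (z 1) (y 1))) := by
    intro k
    rw [mem_closedBall_iff_norm]
    refine Real.le_sqrt_of_sq_le ?_
    rw [← inv_mul_le_iff₀ hγ]
    have h1 : energy γ z₀ y₀ (z (k + 1)) (y (k + 1)) ≤ _ := hanti h₀ (Nat.zero_le k)
    have h2 : 0 ≤ γ * ‖z (k + 1) - z₀‖ ^ 2 := by positivity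
    refine le_trans ?_ h1
    unfold energy
    linarith
  obtain ⟨⟨zs, ys⟩, -, φ, hφ, hlim⟩ :=
    ((isCompact_closedBall z₀ (√(γ⁻¹ * energy γ z₀ y₀ (z 1) (y 1)))).prod
      (isCompact_closedBall y₀ (√(γ * energy γ z₀ y₀ (z 1) (y 1))))).tendsto_subseq
      (x := fun k => (z (k + 1), y (k + 1))) (fun k => ⟨hbz k, hby k⟩)
  have hz1 : Tendsto (fun k => z (φ k + 1)) atTop (𝓝 zs) :=
    (continuous_fst.tendsto _).comp hlim
  have hy1 : Tendsto (fun k => y (φ k + 1)) atTop (𝓝 ys) :=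
    (continuous_snd.tendsto _).comp hlim
  have hz2 : Tendsto (fun k => z (φ k + 2)) atTop (𝓝 zs) := by
    have := (hdz.comp hφ.tendsto_atTop).add hz1
    simpa [Function.comp_def] using this
  have hMx2 : Tendsto (fun k => app M (x (φ k + 2))) atTop (𝓝 zs) := by
    have h1 := hz2.add ((hdy.comp hφ.tendsto_atTop).const_smul γ⁻¹)
    rw [smul_zero, add_zero] at h1
    exact h1.congr fun k => (h.app_eq hγ (φ k + 1)).symm
  -- No cluster point of `x` is available, so `xs` is produced by an `x`-step from the cluster point
  -- `(zs, ys)`; nonexpansiveness identifies `app M xs` with the limit `zs`.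
  obtain ⟨xs, hxs⟩ := xStep_nonempty hf hfl hfc hγ hA zs ys
  have hMxs : app M xs = zs := by
    refine tendsto_nhds_unique (tendsto_iff_norm_sub_tendsto_zero.2 ?_) hMx2
    have h1 : Tendsto (fun k => ‖(z (φ k + 1) - (1 / γ) • y (φ k + 1)) - (zs - (1 / γ) • ys)‖)
        atTop (𝓝 0) :=
      tendsto_iff_norm_sub_tendsto_zero.1 (hz1.sub (hy1.const_smul _))
    refine squeeze_zero (fun k => norm_nonneg _) (fun k => ?_) h1
    exact xStep_nonexpansive hf hfc hγ (h (φ k + 1)).1 hxs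
  obtain ⟨z', hz', -⟩ := zStep_existsUnique (M := M) hg hgl hgc hγ xs ys
  have hz'eq : z' = zs := by
    refine tendsto_nhds_unique (tendsto_iff_norm_sub_tendsto_zero.2 ?_) hz2
    have h1 : Tendsto (fun k => ‖(app M (x (φ k + 2)) + (1 / γ) • y (φ k + 1)) -
        (app M xs + (1 / γ) • ys)‖) atTop (𝓝 0) :=
      tendsto_iff_norm_sub_tendsto_zero.1 ((hMxs ▸ hMx2).add (hy1.const_smul _))
    refine squeeze_zero (fun k => norm_nonneg _) (fun k => ?_) h1
    exact zStep_nonexpansive hg hgc hγ (h (φ k + 1)).2.1 hz'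
  subst hz'eq
  have hKKT : IsKKT f g M xs z' ys := by
    have h1 := xStep_optimality hf hfc hγ hxs
    have h2 := zStep_optimality hg hgc hγ hz'
    rw [hMxs, sub_self, smul_zero, add_zero] at h1 h2
    exact ⟨hMxs, by rwa [hMxs], h2⟩
  -- The energy relative to the new KKT triple also converges, and its limit is read off along the
  -- subsequence.
  have henergy : Tendsto (fun k => energy γ z' ys (z (k + 1)) (y (k + 1))) atTop (𝓝 0) := by
    obtain ⟨v, hv⟩ := hlimit hKKT
    have h1 : Tendsto (fun k => energy γ z' ys (z (φ k + 1)) (y (φ k + 1))) atTop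
        (𝓝 (energy γ z' ys z' ys)) :=
      ((((hz1.sub_const z').norm).pow 2).const_mul γ).add
        ((((hy1.sub_const ys).norm).pow 2).const_mul γ⁻¹)
    have h2 : energy γ z' ys z' ys = 0 := by simp [energy]
    rw [h2] at h1
    rwa [tendsto_nhds_unique (hv.comp hφ.tendsto_atTop) h1] at hv
  have hzlim : Tendsto (fun k => z (k + 1)) atTop (𝓝 z') := by
    refine tendsto_sub_nhds_zero_iff.1
      (tendsto_zero_of_mul_norm_sq_le hγ henergy fun k => ?_)
    have : 0 ≤ γ⁻¹ * ‖y (k + 1) - ys‖ ^ 2 := by positivity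
    unfold energy; linarith
  have hylim : Tendsto (fun k => y (k + 1)) atTop (𝓝 ys) := by
    refine tendsto_sub_nhds_zero_iff.1
      (tendsto_zero_of_mul_norm_sq_le hγ' henergy fun k => ?_)
    have : 0 ≤ γ * ‖z (k + 1) - z'‖ ^ 2 := by positivity
    unfold energy; linarith
  refine ⟨xs, z', ys, hKKT, ?_, (tendsto_add_atTop_iff_nat 1).1 hzlim,
    (tendsto_add_atTop_iff_nat 1).1 hylim⟩
  rw [← tendsto_add_atTop_iff_nat 2, hMxs]
  have h1 := (hzlim.comp (tendsto_add_atTop_nat 1)).add (hdy.const_smul γ⁻¹)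
  rw [smul_zero, add_zero] at h1
  exact h1.congr fun k => (h.app_eq hγ (k + 1)).symm

/-- Strong convexity improves the subgradient inequality. -/
theorem AlphaConvex.subgradient_le {α : ℝ} (hf : AlphaConvex α f)
    {x : EuclideanSpace ℝ (Fin n)} {y : EuclideanSpace ℝ (Fin m)} {r : ℝ} (hr : f x = r)
    (h : ∀ w (s : ℝ), f w ≤ s → r - inner ℝ y (app M w - app M x) ≤ s)
    {w : EuclideanSpace ℝ (Fin n)} {s : ℝ} (hs : f w ≤ s) :
    r - inner ℝ y (app M w - app M x) + α / 4 * ‖x - w‖ ^ 2 ≤ s := by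
  -- The midpoint gain `α/8` doubles to `α/4` when the inequality is rescaled.
  have h1 := h _ _ (hf.le_coe hr.le hs (t := 1 / 2) (by norm_num) (by norm_num))
  rw [← app_sub, add_sub_cancel_left, ← appL_apply, map_smul, appL_apply,
    real_inner_smul_right, app_sub] at h1
  linarith

/-- Adding the strengthened inequalities at `x (k + 1)` and `xs` bounds `α/2 · ‖x (k + 1) - xs‖²` by
a product of a convergent multiplier difference and `Mx (k + 1) - Mxs → 0`. -/
theorem IsADMMSequence.tendsto_of_isStronglyConvex (h : IsADMMSequence f g M γ x z y)
    (hf : IsProper f) (hfc : IsConvex f) (hγ : 0 < γ) (hsc : IsStronglyConvex f)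
    {xs : EuclideanSpace ℝ (Fin n)} {zs ys : EuclideanSpace ℝ (Fin m)}
    (hs : IsKKT f g M xs zs ys)
    (hMx : Tendsto (fun k => app M (x k)) atTop (𝓝 (app M xs)))
    (hz : Tendsto z atTop (𝓝 zs)) (hy : Tendsto y atTop (𝓝 ys)) :
    Tendsto x atTop (𝓝 xs) := by
  obtain ⟨α, hα, hsc⟩ := hsc
  obtain ⟨hM, ⟨a, ha, hfa⟩, -⟩ := hs
  rw [← tendsto_add_atTop_iff_nat 1]
  have hMx1 := (tendsto_add_atTop_iff_nat 1).2 hMx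
  have hlim : Tendsto (fun k => -inner ℝ ((y k + γ • (app M (x (k + 1)) - z k)) - ys)
      (app M (x (k + 1)) - app M xs)) atTop (𝓝 0) := by
    have h1 := ((((hy.add ((hMx1.sub hz).const_smul γ)).sub_const ys).inner
      (𝕜 := ℝ) (hMx1.sub_const (app M xs)))).neg
    rw [sub_self (app M xs), inner_zero_right, neg_zero] at h1
    exact h1
  refine tendsto_sub_nhds_zero_iff.1
    (tendsto_zero_of_mul_norm_sq_le (half_pos hα) hlim fun k => ?_)
  obtain ⟨r, hr, hx⟩ := xStep_optimality hf hfc hγ (h k).1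
  have h1 := hsc.subgradient_le hr hx ha.le
  have h2 := hsc.subgradient_le ha hfa hr.le
  rw [norm_sub_rev] at h2
  rw [← neg_sub (app M (x (k + 1))) (app M xs), inner_neg_right] at h1
  rw [inner_sub_left]
  linarith

theorem app_nonsing_inv_mul (hM : IsUnit (M.transpose * M)) (x : EuclideanSpace ℝ (Fin n)) :
    app ((M.transpose * M)⁻¹ * M.transpose) (app M x) = x := by
  simp only [app, Matrix.mulVec_mulVec, Matrix.mul_assoc]
  rw [Matrix.nonsing_inv_mul _ ((Matrix.isUnit_iff_isUnit_det _).1 hM), Matrix.one_mulVec]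

end ADMM
end

/-! ### Assembly of the theorem -/

open ADMM in
theorem mainTheorem4 {n m : ℕ} (M : Matrix (Fin m) (Fin n) ℝ) (hM : M ≠ 0)
    (f : EuclideanSpace ℝ (Fin n) → EReal) (g : EuclideanSpace ℝ (Fin m) → EReal)
    (hf_proper : ADMM.IsProper f) (hf_lsc : LowerSemicontinuous f) (hf_conv : ADMM.IsConvex f)
    (hg_proper : ADMM.IsProper g) (hg_lsc : LowerSemicontinuous g)
    (hg_conv : ADMM.IsConvex g) :
    -- saddle points and critical points coincide
    (∀ x z y, ADMM.IsSaddlePoint f g M x z y ↔ ADMM.IsCriticalPoint f g M x z y) ∧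
    -- (A.1) or (A.2)
    (((∃ x z y, ADMM.IsSaddlePoint f g M x z y) ∨
        ((∃ x z, ADMM.IsSolution f g M x z) ∧
          0 ∈ intrinsicInterior ℝ (ADMM.dom g - ADMM.app M '' ADMM.dom f))) →
    -- one of (B.1), ..., (B.6)
      (0 ∈ intrinsicInterior ℝ
          (ADMM.dom (ADMM.conjugate f) - Set.range (ADMM.app M.transpose)) ∨
        (intrinsicInterior ℝ (ADMM.ranSubdiff f) ∩
          Set.range (ADMM.app M.transpose)).Nonempty ∨
        (∀ x ∈ {x | ADMM.app M x = 0} \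
            {x | -(ADMM.recession f (-x)) = ADMM.recession f x ∧ ADMM.recession f x = 0}, 0 < ADMM.recession f x) ∨
        ADMM.IsCoercive f ∨
        ADMM.IsStronglyConvex f ∨
        IsUnit (M.transpose * M)) →
      ∀ γ : ℝ, 0 < γ →
        -- the steps of the ADMM are well defined
        (∀ z y, (ADMM.xStep f M γ z y).Nonempty) ∧
        (∀ x y, ∃! z, z ∈ ADMM.zStep g M γ x y) ∧
        -- convergence from every starting point, for every choice of the minimizers
        ∀ (x : ℕ → EuclideanSpace ℝ (Fin n)) (z y : ℕ → EuclideanSpace ℝ (Fin m)),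
          ADMM.IsADMMSequence f g M γ x z y →
          ∃ (xs : EuclideanSpace ℝ (Fin n)) (zs ys : EuclideanSpace ℝ (Fin m)),
            Tendsto (fun k => ADMM.app M (x k)) atTop (𝓝 (ADMM.app M xs)) ∧
            Tendsto z atTop (𝓝 zs) ∧
            Tendsto y atTop (𝓝 ys) ∧
            ADMM.IsCriticalPoint f g M xs zs ys ∧
            ADMM.IsSolution f g M xs zs ∧
            (ADMM.IsStronglyConvex f ∨ IsUnit (M.transpose * M) →
              Tendsto x atTop (𝓝 xs))) := by
  refine ⟨fun x z y => isSaddlePoint_iff_isCriticalPoint hf_proper hg_proper hg_conv,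
    fun hAs hBs γ hγ => ?_⟩
  have hKKT : ∃ xs zs ys, IsKKT f g M xs zs ys := by
    rcases hAs with ⟨x, z, y, h⟩ | ⟨⟨x, z, h⟩, hri⟩
    · exact ⟨x, z, y, isKKT_of_isSaddlePoint hf_proper hg_proper h⟩
    · obtain ⟨y, hy⟩ :=
        exists_isSaddlePoint_of_isSolution hf_proper hg_proper hf_conv hg_conv h hri
      exact ⟨x, z, y, isKKT_of_isSaddlePoint hf_proper hg_proper hy⟩
  have hker : KerRecessionSymmetric (appL M) f := by
    have horth : ∀ {d}, appL M d = 0 → ∀ y, inner ℝ (app M.transpose y) d = 0 := by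
      intro d hd y
      rw [inner_app_transpose, ← appL_apply, hd, inner_zero_right]
    rcases hBs with h | ⟨c, hc, y, rfl⟩ | h | h | h | h
    · refine kerRecessionSymmetric_of_forall_ranSubdiff hf_proper hf_lsc hf_conv
        fun d hd hle u hu => ?_
      -- Pairing with `d` ignores `ran Mᵀ` and is nonpositive on `dom f*`, so it is maximal at the
      -- relative interior point `0` and vanishes on the whole difference set.
      have h1 := inner_eq_of_le_of_mem_intrinsicInterior (d := d) h (by
        rintro _ ⟨u, hu, _, ⟨y, rfl⟩, rfl⟩
        rw [inner_zero_left, inner_sub_left, horth hd, sub_zero]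
        exact hle u hu)
      have h2 := h1 _ (Set.sub_mem_sub (ranSubdiff_subset_dom_conjugate hf_proper hu) ⟨0, rfl⟩)
      rwa [inner_sub_left, horth hd, sub_zero, inner_zero_left] at h2
    · refine kerRecessionSymmetric_of_forall_ranSubdiff hf_proper hf_lsc hf_conv
        fun d hd hle u hu => ?_
      -- The common point lies in `ran Mᵀ`, so pairing with `d` attains its maximum `0` there.
      rw [inner_eq_of_le_of_mem_intrinsicInterior (d := d) hc (fun v hv => ?_) u hu, horth hd]
      rw [horth hd]
      exact hle v (ranSubdiff_subset_dom_conjugate hf_proper hv)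
    · exact kerRecessionSymmetric_of_recession_pos hf_proper h
    · exact kerRecessionSymmetric_of_eq_zero fun d _ hd => h.eq_zero_of_recession hf_proper hd
    · exact kerRecessionSymmetric_of_eq_zero fun d _ hd =>
        h.eq_zero_of_recession hf_proper hf_lsc hf_conv hd
    · refine kerRecessionSymmetric_of_eq_zero fun d hd _ => ?_
      rw [← app_nonsing_inv_mul h d, ← appL_apply (M := M), hd, ← appL_apply, map_zero]
  refine ⟨xStep_nonempty hf_proper hf_lsc hf_conv hγ hker,
    zStep_existsUnique hg_proper hg_lsc hg_conv hγ, fun x z y hseq => ?_⟩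
  obtain ⟨xs, zs, ys, hs, hMx, hz, hy⟩ := hseq.exists_tendsto hf_proper hf_lsc hf_conv
    hg_proper hg_lsc hg_conv hγ hker hKKT
  refine ⟨xs, zs, ys, hMx, hz, hy,
    (isCriticalPoint_iff_isKKT hf_proper hg_proper hg_conv).2 hs,
    hs.isSolution hf_proper hg_proper, ?_⟩
  rintro (h | h)
  · exact hseq.tendsto_of_isStronglyConvex hf_proper hf_conv hγ h hs hMx hz hy
  · have h1 := ((appL ((M.transpose * M)⁻¹ * M.transpose)).continuous.tendsto _).comp hMx
    simpa [Function.comp_def, appL_apply, app_nonsing_inv_mul h] using h1
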